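/- **Setting.** Let $(\mathcal M,\circ,I,\bullet,J)$ be a duoidal category: a category with two (not necessarily strict) monoidal structures $(\circ,I)$ and $(\bullet,J)$, morphisms $\delta:I\to I\bullet I$, $\varpi:J\circ J\to J$, $\tau:I\to J$ and a natural interchange law $\zeta:(A\bullet B)\circ(C\bullet D)\to(A\circ C)\bullet(B\circ D)$, such that $(J,\varpi,\tau)$ is a $\circ$-monoid, $(I,\delta,\tau)$ is a $\bullet$-comonoid, and $\zeta$ satisfies the usual associativity and unitality axioms with respect to both products. Assume that idempotent morphisms in $\mathcal M$ split. (Composition is written $f.g$, meaning first $g$, then $f$; identity morphisms are denoted by their objects, and associators and unitors are suppressed.) The following transformations turn notions for duoidal categories into notions of the same type: "$\circ$" replaces $\circ$ by the opposite product, "$\bullet$" replaces $\bullet$ by the opposite product, and "$\ast$" replaces $(\mathcal M,\circ,\bullet)$ by $(\mathcal M^{\mathrm{op}},\bullet,\circ)$. **Weak bimonoids.** Let $A$ carry a monoid structure $(\mu,\eta)$ in $(\mathcal M,\circ)$ and a comonoid structure $(\Delta,\varepsilon)$ in $(\mathcal M,\bullet)$. It is a *right weak bimonoid* if $\Delta.\mu=(\mu\bullet\mu).\zeta.(\Delta\circ\Delta)$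 and the following four axioms hold. * (RRU): the composite $$I\xrightarrow{\delta}I\bullet I\xrightarrow{I\bullet\Delta.\eta}I\bullet A\bullet A\xrightarrow{((I\bullet A)\circ\delta)\bullet A}((I\bullet A)\circ(I\bullet I))\bullet A\xrightarrow{((I\bullet A)\circ(I\bullet\Delta.\eta))\bullet A}((I\bullet A)\circ(I\bullet A\bullet A))\bullet A\xrightarrow{\zeta\bullet A}I\bullet A\bullet(A\circ A)\bullet A\xrightarrow{I\bullet A\bullet\mu\bullet A}I\bullet A\bullet A\bullet A$$ equals $(I\bullet A\bullet\Delta).(I\bullet\Delta).(I\bullet\eta).\delta$; * (LRU): the image of (RRU) under the transformation $\bullet$; * (LLC): writing $\kappa:=\varpi.(J\circ\varepsilon.\mu):J\circ A\circ A\to J$, the composite $$J\circ A\circ A\circ A\xrightarrow{J\circ A\circ\Delta\circ A}J\circ A\circ(A\bullet A)\circ A\xrightarrow{\zeta\circ A}((J\circ A)\bullet(J\circ A\circ A))\circ A\xrightarrow{((J\circ A)\bullet\kappa)\circ A}J\circ A\circ A\xrightarrow{\kappa}J$$ equals $\varpi.(J\circ\varepsilon).(J\circ\mu).(J\circ A\circ\mu)$;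 * (LRC): the image of (LLC) under the transformation $\bullet$. It is a *left weak bimonoid* if it satisfies the images of these axioms under the transformation $\circ$, and a *weak bimonoid* if it is both a right and a left weak bimonoid. **Base objects.** Let $\sqcap^R_\circ:J\circ A\to J\circ A$ be the composite $$J\circ A\xrightarrow{J\circ A\circ\Delta.\eta}J\circ A\circ(A\bullet A)\xrightarrow{\zeta}(J\circ A)\bullet(J\circ A\circ A)\xrightarrow{(J\circ A)\bullet\kappa}J\circ A .$$ Whenever $J\circ A\xrightarrow{\pi}R_\circ\xrightarrow{\iota}J\circ A$ is a splitting of $\sqcap^R_\circ$ (that is, $\iota.\pi=\sqcap^R_\circ$ and $\pi.\iota=R_\circ$), equip $R_\circ$ with the $A$-action $\varphi=\pi.(J\circ\mu).(\iota\circ A):R_\circ\circ A\to R_\circ$, put $\chi=(\varphi\bullet\varphi).\zeta.((R_\circ\bullet R_\circ)\circ\Delta.\eta):R_\circ\bullet R_\circ\to R_\circ\bullet R_\circ$, and define a multiplication, unit, comultiplication and counit of $R_\circ$ in $(\mathcal M,\bullet)$ by $$\eta^R=\pi.(J\circ\eta),\qquad \varepsilon^R=\varpi.(J\circ\varepsilon).\iota,\qquad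 \mu^R=(R_\circ\bullet\varepsilon^R).\chi,\qquad \Delta^R=\chi.(R_\circ\bullet\eta^R).$$ Applying the transformations to $\sqcap^R_\circ$ and to these structure morphisms gives the eight base objects with their structure morphisms: $\overline L_\circ$, $\overline R_\circ$ and $L_\circ$ are obtained from $R_\circ$ by $\bullet$, by $\circ$, and by both $\circ$ and $\bullet$, respectively; and $R_\bullet$, $\overline R_\bullet$, $\overline L_\bullet$, $L_\bullet$ are obtained by $\ast$ from $R_\circ$, $\overline L_\circ$, $\overline R_\circ$, $L_\circ$, respectively. They are retracts of $J\circ A$ (for $R_\circ,\overline L_\circ$), $A\circ J$ (for $L_\circ,\overline R_\circ$), $I\bullet A$ (for $R_\bullet,\overline R_\bullet$) and $A\bullet I$ (for $L_\bullet,\overline L_\bullet$). **Proposition.** For any weak bimonoid $A$ in a duoidal category $(\mathcal M,\circ,\bullet)$ in which idempotent morphisms split, the eight base objects exist, that is, the eight endomorphisms defining them have splittings. For any choice of the splittings, the structure morphisms above make each of $L_\bullet,\overline L_\bullet,R_\bullet,\overline R_\bullet$ a monoid and a comonoid in $(\mathcal M,\circ)$ and each of $L_\circ,\overline L_\circ,R_\circ,\overline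 R_\circ$ a monoid and a comonoid in $(\mathcal M,\bullet)$. Moreover there are isomorphisms, each of which is simultaneously an isomorphism of monoids and an isomorphism of comonoids: 1. $L_\bullet\cong\overline L_\bullet$ in $(\mathcal M,\circ)$; 2. $R_\bullet\cong\overline R_\bullet$ in $(\mathcal M,\circ)$; 3. $L_\circ\cong\overline R_\circ$ in $(\mathcal M,\bullet)$; 4. $R_\circ\cong\overline L_\circ$ in $(\mathcal M,\bullet)$. -/

import Mathlib

open CategoryTheory Opposite

universe v u

namespace Duoidal

/-! ### Monoidal structures on the same category, and their opposites -/

section Monoidal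

variable {C : Type u} [Category.{v} C]

/-- The monoidal structure on `C` with the opposite monoidal product `(X, Y) ↦ Y ⊗ X`. -/
abbrev rev (V : MonoidalCategory C) : MonoidalCategory C where
  tensorObj X Y := V.tensorObj Y X
  whiskerLeft X _ _ f := V.whiskerRight f X
  whiskerRight f X := V.whiskerLeft X f
  tensorHom f g := V.tensorHom g f
  tensorUnit := V.tensorUnit
  associator X Y Z := (V.associator Z Y X).symm
  leftUnitor X := V.rightUnitor X
  rightUnitor X := V.leftUnitor X
  tensorHom_def _ _ := MonoidalCategory.tensorHom_def' _ _
  associator_naturality _ _ _ := MonoidalCategory.associator_inv_naturality _ _ _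
  triangle _ _ := MonoidalCategory.triangle_assoc_comp_right _ _
  pentagon _ _ _ _ := MonoidalCategory.pentagon_inv

/-- The monoidal structure on `Cᵒᵖ` with the same monoidal product on objects. -/
abbrev opp (V : MonoidalCategory C) : MonoidalCategory Cᵒᵖ := @monoidalCategoryOp C _ V

/-- Inverting the isomorphisms in a commutative square. -/
theorem square_inv {P Q R S : C} (a : P ≅ Q) (b : R ≅ S) {f : P ⟶ R} {g : Q ⟶ S}
    (h : f ≫ b.hom = a.hom ≫ g) : g ≫ b.inv = a.inv ≫ f := by
  rw [Iso.comp_inv_eq, Category.assoc, h, Iso.inv_hom_id_assoc]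

theorem assoc_four {P Q R S T : C} {a : P ⟶ Q} {b : Q ⟶ R} {c : R ⟶ S} {d : S ⟶ T} {e : P ⟶ T}
    (h : a ≫ b ≫ c ≫ d = e) : ((a ≫ b) ≫ c) ≫ d = e := by
  rw [Category.assoc, Category.assoc, h]

end Monoidal

section Duoidal

variable {C : Type u} [Category.{v} C] (circ bullet : MonoidalCategory C)

local notation "𝐈" => circ.tensorUnit
local notation "𝐉" => bullet.tensorUnit
local infixr:70 " ⊚ " => circ.tensorObj
local infixr:70 " ⊛ " => bullet.tensorObj
local infixr:70 " ⊚ₘ " => circ.tensorHom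
local infixr:70 " ⊛ₘ " => bullet.tensorHom
local infixr:81 " ◁⊚ " => circ.whiskerLeft
local infixl:81 " ▷⊚ " => circ.whiskerRight
local infixr:81 " ◁⊛ " => bullet.whiskerLeft
local infixl:81 " ▷⊛ " => bullet.whiskerRight
local notation "α⊚" => circ.associator
local notation "α⊛" => bullet.associator
local notation "λ⊚" => circ.leftUnitor
local notation "λ⊛" => bullet.leftUnitor
local notation "ρ⊚" => circ.rightUnitor
local notation "ρ⊛" => bullet.rightUnitor

/-- A duoidal structure on a category with two monoidal structures:
`circ`, with product `⊚` and unit `𝐈`, and `bullet`, with product `⊛` and unit `𝐉`. -/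
structure DuoidalStructure where
  δ : 𝐈 ⟶ 𝐈 ⊛ 𝐈
  ϖ : 𝐉 ⊚ 𝐉 ⟶ 𝐉
  τ : 𝐈 ⟶ 𝐉
  /-- the interchange law -/
  ζ (X Y Z W : C) : (X ⊛ Y) ⊚ (Z ⊛ W) ⟶ (X ⊚ Z) ⊛ (Y ⊚ W)
  ζ_natural {X X' Y Y' Z Z' W W' : C} (f : X ⟶ X') (g : Y ⟶ Y') (h : Z ⟶ Z') (k : W ⟶ W') :
    ((f ⊛ₘ g) ⊚ₘ (h ⊛ₘ k)) ≫ ζ X' Y' Z' W' = ζ X Y Z W ≫ ((f ⊚ₘ h) ⊛ₘ (g ⊚ₘ k))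
  /-- `(𝐉, ϖ, τ)` is a monoid with respect to `⊚` -/
  τ_ϖ : τ ▷⊚ 𝐉 ≫ ϖ = (λ⊚ 𝐉).hom
  ϖ_τ : 𝐉 ◁⊚ τ ≫ ϖ = (ρ⊚ 𝐉).hom
  ϖ_assoc : ϖ ▷⊚ 𝐉 ≫ ϖ = (α⊚ 𝐉 𝐉 𝐉).hom ≫ 𝐉 ◁⊚ ϖ ≫ ϖ
  /-- `(𝐈, δ, τ)` is a comonoid with respect to `⊛` -/
  δ_τ : δ ≫ τ ▷⊛ 𝐈 = (λ⊛ 𝐈).inv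
  τ_δ : δ ≫ 𝐈 ◁⊛ τ = (ρ⊛ 𝐈).inv
  δ_coassoc : δ ≫ 𝐈 ◁⊛ δ = δ ≫ δ ▷⊛ 𝐈 ≫ (α⊛ 𝐈 𝐈 𝐈).hom
  /-- associativity of `ζ` with respect to `⊚` -/
  ζ_assoc_circ (X Y Z W U V : C) :
    ζ X Y Z W ▷⊚ (U ⊛ V) ≫ ζ (X ⊚ Z) (Y ⊚ W) U V ≫ ((α⊚ X Z U).hom ⊛ₘ (α⊚ Y W V).hom) =
      (α⊚ (X ⊛ Y) (Z ⊛ W) (U ⊛ V)).hom ≫ (X ⊛ Y) ◁⊚ ζ Z W U V ≫ ζ X Y (Z ⊚ U) (W ⊚ V)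
  /-- associativity of `ζ` with respect to `⊛` -/
  ζ_assoc_bullet (X Y Z W U V : C) :
    ζ (X ⊛ Y) Z (W ⊛ U) V ≫ ζ X Y W U ▷⊛ (Z ⊚ V) ≫ (α⊛ (X ⊚ W) (Y ⊚ U) (Z ⊚ V)).hom =
      ((α⊛ X Y Z).hom ⊚ₘ (α⊛ W U V).hom) ≫ ζ X (Y ⊛ Z) W (U ⊛ V) ≫ (X ⊚ W) ◁⊛ ζ Y Z U V
  /-- unitality of `ζ` with respect to `⊚` -/
  ζ_unit_left_circ (X Y : C) :
    (λ⊚ (X ⊛ Y)).inv ≫ δ ▷⊚ (X ⊛ Y) ≫ ζ 𝐈 𝐈 X Y ≫ ((λ⊚ X).hom ⊛ₘ (λ⊚ Y).hom) = 𝟙 (X ⊛ Y)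
  ζ_unit_right_circ (X Y : C) :
    (ρ⊚ (X ⊛ Y)).inv ≫ (X ⊛ Y) ◁⊚ δ ≫ ζ X Y 𝐈 𝐈 ≫ ((ρ⊚ X).hom ⊛ₘ (ρ⊚ Y).hom) = 𝟙 (X ⊛ Y)
  /-- unitality of `ζ` with respect to `⊛` -/
  ζ_unit_left_bullet (X Y : C) :
    ((λ⊛ X).inv ⊚ₘ (λ⊛ Y).inv) ≫ ζ 𝐉 X 𝐉 Y ≫ ϖ ▷⊛ (X ⊚ Y) ≫ (λ⊛ (X ⊚ Y)).hom = 𝟙 (X ⊚ Y)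
  ζ_unit_right_bullet (X Y : C) :
    ((ρ⊛ X).inv ⊚ₘ (ρ⊛ Y).inv) ≫ ζ X 𝐉 Y 𝐉 ≫ (X ⊚ Y) ◁⊛ ϖ ≫ (ρ⊛ (X ⊚ Y)).hom = 𝟙 (X ⊚ Y)

/-- A monoid structure with respect to `⊚` and a comonoid structure with respect to `⊛`. -/
structure MonoidComonoid (A : C) where
  mon : @MonObj C _ circ A
  comon : @ComonObj C _ bullet A

variable {circ bullet}

namespace MonoidComonoid

variable {A : C} (B : MonoidComonoid circ bullet A)

def μ : A ⊚ A ⟶ A := B.mon.mul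
def η : 𝐈 ⟶ A := B.mon.one
def Δ : A ⟶ A ⊛ A := B.comon.comul
def ε : A ⟶ 𝐉 := B.comon.counit

end MonoidComonoid

/-! ### The weak bimonoid axioms -/

namespace DuoidalStructure

variable (D : DuoidalStructure circ bullet) {A : C} (B : MonoidComonoid circ bullet A)

/-- The morphism `(𝐉 ⊚ A) ⊚ A ⟶ 𝐉` given by `ε.μ` followed by `ϖ`. -/
def counitMul : (𝐉 ⊚ A) ⊚ A ⟶ 𝐉 :=
  (α⊚ 𝐉 A A).hom ≫ 𝐉 ◁⊚ (B.μ ≫ B.ε) ≫ D.ϖ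

/-- The multiplication is comultiplicative. -/
def MulComul : Prop :=
  B.μ ≫ B.Δ = (B.Δ ⊚ₘ B.Δ) ≫ D.ζ A A A A ≫ (B.μ ⊛ₘ B.μ)

/-- Weak comultiplicativity of the unit, first axiom. -/
def RRU : Prop :=
  D.δ ≫ 𝐈 ◁⊛ (B.η ≫ B.Δ) ≫ (α⊛ 𝐈 A A).inv ≫ (ρ⊚ (𝐈 ⊛ A)).inv ▷⊛ A ≫
      ((𝐈 ⊛ A) ◁⊚ D.δ) ▷⊛ A ≫
      ((𝐈 ⊛ A) ◁⊚ (𝐈 ◁⊛ (B.η ≫ B.Δ))) ▷⊛ A ≫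
      ((𝐈 ⊛ A) ◁⊚ (α⊛ 𝐈 A A).inv) ▷⊛ A ≫
      D.ζ 𝐈 A (𝐈 ⊛ A) A ▷⊛ A ≫
      ((λ⊚ (𝐈 ⊛ A)).hom ▷⊛ (A ⊚ A)) ▷⊛ A ≫
      ((𝐈 ⊛ A) ◁⊛ B.μ) ▷⊛ A =
    D.δ ≫ 𝐈 ◁⊛ B.η ≫ 𝐈 ◁⊛ B.Δ ≫ (α⊛ 𝐈 A A).inv ≫ (𝐈 ⊛ A) ◁⊛ B.Δ ≫ (α⊛ (𝐈 ⊛ A) A A).inv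

/-- Weak comultiplicativity of the unit, second axiom: the mirror image of `RRU` with respect
to `⊛`. -/
def LRU : Prop :=
  D.δ ≫ (B.η ≫ B.Δ) ▷⊛ 𝐈 ≫ (α⊛ A A 𝐈).hom ≫ A ◁⊛ (ρ⊚ (A ⊛ 𝐈)).inv ≫
      A ◁⊛ ((A ⊛ 𝐈) ◁⊚ D.δ) ≫
      A ◁⊛ ((A ⊛ 𝐈) ◁⊚ ((B.η ≫ B.Δ) ▷⊛ 𝐈)) ≫
      A ◁⊛ ((A ⊛ 𝐈) ◁⊚ (α⊛ A A 𝐈).hom) ≫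
      A ◁⊛ D.ζ A 𝐈 A (A ⊛ 𝐈) ≫
      A ◁⊛ ((A ⊚ A) ◁⊛ (λ⊚ (A ⊛ 𝐈)).hom) ≫
      A ◁⊛ (B.μ ▷⊛ (A ⊛ 𝐈)) =
    D.δ ≫ B.η ▷⊛ 𝐈 ≫ B.Δ ▷⊛ 𝐈 ≫ (α⊛ A A 𝐈).hom ≫ B.Δ ▷⊛ (A ⊛ 𝐈) ≫ (α⊛ A A (A ⊛ 𝐈)).hom

/-- Weak multiplicativity of the counit, first axiom. -/
def LRC : Prop :=
  ((𝐉 ⊚ A) ◁⊚ B.Δ) ▷⊚ A ≫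
      ((ρ⊛ (𝐉 ⊚ A)).inv ▷⊚ (A ⊛ A)) ▷⊚ A ≫
      D.ζ (𝐉 ⊚ A) 𝐉 A A ▷⊚ A ≫
      (D.counitMul B ▷⊛ (𝐉 ⊚ A)) ▷⊚ A ≫
      (λ⊛ (𝐉 ⊚ A)).hom ▷⊚ A ≫ D.counitMul B =
    (α⊚ (𝐉 ⊚ A) A A).hom ≫ (𝐉 ⊚ A) ◁⊚ B.μ ≫
      (α⊚ 𝐉 A A).hom ≫ 𝐉 ◁⊚ B.μ ≫ 𝐉 ◁⊚ B.ε ≫ D.ϖ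

/-- Weak multiplicativity of the counit, second axiom: the mirror image of `LRC` with respect
to `⊛`. -/
def LLC : Prop :=
  ((𝐉 ⊚ A) ◁⊚ B.Δ) ▷⊚ A ≫
      ((λ⊛ (𝐉 ⊚ A)).inv ▷⊚ (A ⊛ A)) ▷⊚ A ≫
      D.ζ 𝐉 (𝐉 ⊚ A) A A ▷⊚ A ≫
      ((𝐉 ⊚ A) ◁⊛ D.counitMul B) ▷⊚ A ≫
      (ρ⊛ (𝐉 ⊚ A)).hom ▷⊚ A ≫ D.counitMul B =
    (α⊚ (𝐉 ⊚ A) A A).hom ≫ (𝐉 ⊚ A) ◁⊚ B.μ ≫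
      (α⊚ 𝐉 A A).hom ≫ 𝐉 ◁⊚ B.μ ≫ 𝐉 ◁⊚ B.ε ≫ D.ϖ

/-- Right weak bimonoids. -/
structure IsRightWeakBimonoid : Prop where
  mulComul : D.MulComul B
  rru : D.RRU B
  lru : D.LRU B
  lrc : D.LRC B
  llc : D.LLC B

end DuoidalStructure

/-! ### The symmetries of duoidal structures -/

namespace DuoidalStructure

variable (D : DuoidalStructure circ bullet)

/-- The transformation `∘`: replace `⊚` by the opposite product. -/
def circRev : DuoidalStructure (rev circ) bullet where
  δ := D.δ
  ϖ := D.ϖ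
  τ := D.τ
  ζ X Y Z W := D.ζ Z W X Y
  ζ_natural f g h k := D.ζ_natural h k f g
  τ_ϖ := D.ϖ_τ
  ϖ_τ := D.τ_ϖ
  ϖ_assoc := by
    have := D.ϖ_assoc
    exact ((Iso.inv_comp_eq _).2 this).symm
  δ_τ := D.δ_τ
  τ_δ := D.τ_δ
  δ_coassoc := D.δ_coassoc
  ζ_assoc_circ X Y Z W U V := by
    have h := square_inv (α⊚ (U ⊛ V) (Z ⊛ W) (X ⊛ Y))
      (@MonoidalCategory.tensorIso C _ bullet _ _ _ _ (α⊚ U Z X) (α⊚ V W Y))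
      ((Category.assoc _ _ _).trans (D.ζ_assoc_circ U V Z W X Y))
    rw [Category.assoc] at h
    exact h
  ζ_assoc_bullet X Y Z W U V := D.ζ_assoc_bullet W U V X Y Z
  ζ_unit_left_circ := D.ζ_unit_right_circ
  ζ_unit_right_circ := D.ζ_unit_left_circ
  ζ_unit_left_bullet X Y := D.ζ_unit_left_bullet Y X
  ζ_unit_right_bullet X Y := D.ζ_unit_right_bullet Y X

/-- The transformation `•`: replace `⊛` by the opposite product. -/
def bulletRev : DuoidalStructure circ (rev bullet) where
  δ := D.δ
  ϖ := D.ϖ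
  τ := D.τ
  ζ X Y Z W := D.ζ Y X W Z
  ζ_natural f g h k := D.ζ_natural g f k h
  τ_ϖ := D.τ_ϖ
  ϖ_τ := D.ϖ_τ
  ϖ_assoc := D.ϖ_assoc
  δ_τ := D.τ_δ
  τ_δ := D.δ_τ
  δ_coassoc := by
    have h := square_inv (Iso.refl 𝐈) (α⊛ 𝐈 𝐈 𝐈) (f := D.δ ≫ D.δ ▷⊛ 𝐈) (g := D.δ ≫ 𝐈 ◁⊛ D.δ)
      (by rw [Category.assoc, Iso.refl_hom, Category.id_comp]; exact D.δ_coassoc.symm)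
    rw [Category.assoc, Iso.refl_inv, Category.id_comp] at h
    exact h.symm
  ζ_assoc_circ X Y Z W U V := D.ζ_assoc_circ Y X W Z V U
  ζ_assoc_bullet X Y Z W U V := by
    have h := square_inv
      (@MonoidalCategory.tensorIso C _ circ _ _ _ _ (α⊛ Z Y X) (α⊛ V U W))
      (α⊛ (Z ⊚ V) (Y ⊚ U) (X ⊚ W))
      ((Category.assoc _ _ _).trans (D.ζ_assoc_bullet Z Y X V U W))
    rw [Category.assoc] at h
    exact h
  ζ_unit_left_circ X Y := D.ζ_unit_left_circ Y X
  ζ_unit_right_circ X Y := D.ζ_unit_right_circ Y X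
  ζ_unit_left_bullet := D.ζ_unit_right_bullet
  ζ_unit_right_bullet := D.ζ_unit_left_bullet

/-- The transformation `∗`: pass to the opposite category and exchange the roles of the
two monoidal products. -/
def op : DuoidalStructure (opp bullet) (opp circ) where
  δ := D.ϖ.op
  ϖ := D.δ.op
  τ := D.τ.op
  ζ X Y Z W := (D.ζ X.unop Z.unop Y.unop W.unop).op
  ζ_natural f g h k :=
    Quiver.Hom.unop_inj (D.ζ_natural f.unop h.unop g.unop k.unop).symm
  τ_ϖ := Quiver.Hom.unop_inj D.δ_τ
  ϖ_τ := Quiver.Hom.unop_inj D.τ_δ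
  ϖ_assoc := by
    have h := square_inv (Iso.refl 𝐈) (α⊛ 𝐈 𝐈 𝐈) (f := D.δ ≫ D.δ ▷⊛ 𝐈) (g := D.δ ≫ 𝐈 ◁⊛ D.δ)
      (by rw [Category.assoc, Iso.refl_hom, Category.id_comp]; exact D.δ_coassoc.symm)
    rw [Iso.refl_inv, Category.id_comp] at h
    exact Quiver.Hom.unop_inj h.symm
  δ_τ := Quiver.Hom.unop_inj D.τ_ϖ
  τ_δ := Quiver.Hom.unop_inj D.ϖ_τ
  δ_coassoc := by
    have h := D.ϖ_assoc
    rw [← Iso.inv_comp_eq] at h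
    refine Quiver.Hom.unop_inj (h.symm.trans ?_)
    exact (Category.assoc _ _ _).symm
  ζ_assoc_circ X Y Z W U V := by
    have h := square_inv
      (@MonoidalCategory.tensorIso C _ circ _ _ _ _
        (α⊛ X.unop Z.unop U.unop) (α⊛ Y.unop W.unop V.unop))
      (α⊛ (X.unop ⊚ Y.unop) (Z.unop ⊚ W.unop) (U.unop ⊚ V.unop))
      ((Category.assoc _ _ _).trans (D.ζ_assoc_bullet _ _ _ _ _ _))
    exact Quiver.Hom.unop_inj ((Category.assoc _ _ _).trans h.symm)
  ζ_assoc_bullet X Y Z W U V := by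
    have h := square_inv
      (α⊚ (X.unop ⊛ W.unop) (Y.unop ⊛ U.unop) (Z.unop ⊛ V.unop))
      (@MonoidalCategory.tensorIso C _ bullet _ _ _ _
        (α⊚ X.unop Y.unop Z.unop) (α⊚ W.unop U.unop V.unop))
      ((Category.assoc _ _ _).trans (D.ζ_assoc_circ _ _ _ _ _ _))
    exact Quiver.Hom.unop_inj ((Category.assoc _ _ _).trans h.symm)
  ζ_unit_left_circ X Y := by
    have h := D.ζ_unit_left_bullet X.unop Y.unop
    exact Quiver.Hom.unop_inj (assoc_four h)
  ζ_unit_right_circ X Y := by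
    have h := D.ζ_unit_right_bullet X.unop Y.unop
    exact Quiver.Hom.unop_inj (assoc_four h)
  ζ_unit_left_bullet X Y := by
    have h := D.ζ_unit_left_circ X.unop Y.unop
    exact Quiver.Hom.unop_inj (assoc_four h)
  ζ_unit_right_bullet X Y := by
    have h := D.ζ_unit_right_circ X.unop Y.unop
    exact Quiver.Hom.unop_inj (assoc_four h)

end DuoidalStructure

namespace MonoidComonoid

variable {A : C} (B : MonoidComonoid circ bullet A)

/-- The same monoid and comonoid, viewed in the category with opposite product `⊚`. -/
def circRev : MonoidComonoid (rev circ) bullet A where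
  mon := @MonObj.mk C _ (rev circ) A B.mon.one B.mon.mul B.mon.mul_one B.mon.one_mul
    ((Iso.inv_comp_eq _).2 B.mon.mul_assoc).symm
  comon := B.comon

/-- The same monoid and comonoid, viewed in the category with opposite product `⊛`. -/
def bulletRev : MonoidComonoid circ (rev bullet) A where
  mon := B.mon
  comon := @ComonObj.mk C _ (rev bullet) A B.comon.counit B.comon.comul
    B.comon.comul_counit B.comon.counit_comul (by
      have h := square_inv (Iso.refl A) (α⊛ A A A) (f := B.Δ ≫ B.Δ ▷⊛ A) (g := B.Δ ≫ A ◁⊛ B.Δ)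
        (by rw [Category.assoc, Iso.refl_hom, Category.id_comp]; exact B.comon.comul_assoc.symm)
      rw [Category.assoc, Iso.refl_inv, Category.id_comp] at h
      exact h.symm)

/-- The monoid becomes a comonoid, and the comonoid becomes a monoid, in the opposite category. -/
def op : MonoidComonoid (opp bullet) (opp circ) (Opposite.op A) where
  mon := @MonObj.mk Cᵒᵖ _ (opp bullet) (Opposite.op A) B.ε.op B.Δ.op
    (Quiver.Hom.unop_inj B.comon.counit_comul) (Quiver.Hom.unop_inj B.comon.comul_counit) (by
      have h := square_inv (Iso.refl A) (α⊛ A A A) (f := B.Δ ≫ B.Δ ▷⊛ A) (g := B.Δ ≫ A ◁⊛ B.Δ)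
        (by rw [Category.assoc, Iso.refl_hom, Category.id_comp]; exact B.comon.comul_assoc.symm)
      rw [Iso.refl_inv, Category.id_comp] at h
      exact Quiver.Hom.unop_inj h.symm)
  comon := @ComonObj.mk Cᵒᵖ _ (opp circ) (Opposite.op A) B.η.op B.μ.op
    (Quiver.Hom.unop_inj B.mon.one_mul) (Quiver.Hom.unop_inj B.mon.mul_one) (by
      have h := B.mon.mul_assoc
      rw [← Iso.inv_comp_eq] at h
      exact Quiver.Hom.unop_inj (h.symm.trans (Category.assoc _ _ _).symm))

end MonoidComonoid

namespace DuoidalStructure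

variable (D : DuoidalStructure circ bullet) {A : C} (B : MonoidComonoid circ bullet A)

/-- Left weak bimonoids: the axioms are the images under the transformation `∘` of the
axioms of right weak bimonoids (`MulComul` being invariant under it). -/
def IsLeftWeakBimonoid : Prop := D.circRev.IsRightWeakBimonoid B.circRev

/-- Weak bimonoids. -/
def IsWeakBimonoid : Prop := D.IsRightWeakBimonoid B ∧ D.IsLeftWeakBimonoid B

end DuoidalStructure

/-! ### Monoids and comonoids in the same monoidal category -/

/-- The structure morphisms (without any axioms) of a monoid and comonoid `R` in `(C, V)`. -/
structure MonComonData (V : MonoidalCategory C) (R : C) where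
  mul : V.tensorObj R R ⟶ R
  one : V.tensorUnit ⟶ R
  comul : R ⟶ V.tensorObj R R
  counit : R ⟶ V.tensorUnit

namespace MonComonData

variable {V : MonoidalCategory C} {R S : C}

/-- The structure morphisms are those of a monoid and of a comonoid in `(C, V)`. -/
def IsMonoidAndComonoid (P : MonComonData V R) : Prop :=
  (∃ m : @MonObj C _ V R, m.mul = P.mul ∧ m.one = P.one) ∧
    ∃ c : @ComonObj C _ V R, c.comul = P.comul ∧ c.counit = P.counit

/-- There is an isomorphism compatible with all structure morphisms. -/
def Isomorphic (P : MonComonData V R) (Q : MonComonData V S) : Prop :=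
  ∃ e : R ≅ S,
    P.mul ≫ e.hom = V.tensorHom e.hom e.hom ≫ Q.mul ∧ P.one ≫ e.hom = Q.one ∧
    e.hom ≫ Q.comul = P.comul ≫ V.tensorHom e.hom e.hom ∧ e.hom ≫ Q.counit = P.counit

/-- Monoids and comonoids are the same for a monoidal product and for its opposite. -/
def unrev (P : MonComonData (rev V) R) : MonComonData V R where
  mul := P.mul
  one := P.one
  comul := P.comul
  counit := P.counit

/-- Monoids in the opposite category are comonoids, and conversely. -/
def unop (P : MonComonData (opp V) (op R)) : MonComonData V R where
  mul := P.comul.unop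
  one := P.counit.unop
  comul := P.mul.unop
  counit := P.one.unop

end MonComonData

/-! ### The base objects -/

namespace DuoidalStructure

variable (D : DuoidalStructure circ bullet) {A : C} (B : MonoidComonoid circ bullet A)

/-- The morphism `⊓^R_∘`. -/
def sqcap : 𝐉 ⊚ A ⟶ 𝐉 ⊚ A :=
  (ρ⊚ (𝐉 ⊚ A)).inv ≫ (𝐉 ⊚ A) ◁⊚ (B.η ≫ B.Δ) ≫ (λ⊛ (𝐉 ⊚ A)).inv ▷⊚ (A ⊛ A) ≫
    D.ζ 𝐉 (𝐉 ⊚ A) A A ≫ (𝐉 ⊚ A) ◁⊛ D.counitMul B ≫ (ρ⊛ (𝐉 ⊚ A)).hom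

/-- The morphism `χ_{F,G}` for right `A`-actions `φ` on `F` and `γ` on `G`. -/
def chi {F G : C} (φ : F ⊚ A ⟶ F) (γ : G ⊚ A ⟶ G) : F ⊛ G ⟶ F ⊛ G :=
  (ρ⊚ (F ⊛ G)).inv ≫ (F ⊛ G) ◁⊚ (B.η ≫ B.Δ) ≫ D.ζ F G A A ≫ (φ ⊛ₘ γ)

variable {R : C}

/-- The right `A`-action on a retract of `𝐉 ⊚ A`. -/
def baseAct (h : Retract R (𝐉 ⊚ A)) : R ⊚ A ⟶ R :=
  h.i ▷⊚ A ≫ (α⊚ 𝐉 A A).hom ≫ 𝐉 ◁⊚ B.μ ≫ h.r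

def baseOne (h : Retract R (𝐉 ⊚ A)) : 𝐉 ⟶ R := (ρ⊚ 𝐉).inv ≫ 𝐉 ◁⊚ B.η ≫ h.r

def baseCounit (h : Retract R (𝐉 ⊚ A)) : R ⟶ 𝐉 := h.i ≫ 𝐉 ◁⊚ B.ε ≫ D.ϖ

/-- The structure morphisms in `(C, ⊛)` of the base object `R_∘`, given as a retract of `𝐉 ⊚ A`
(to be used for a retract that splits `⊓^R_∘`). -/
def baseData (h : Retract R (𝐉 ⊚ A)) : MonComonData bullet R where
  mul := D.chi B (baseAct B h) (baseAct B h) ≫ R ◁⊛ D.baseCounit B h ≫ (ρ⊛ R).hom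
  one := baseOne B h
  comul := (ρ⊛ R).inv ≫ R ◁⊛ baseOne B h ≫ D.chi B (baseAct B h) (baseAct B h)
  counit := D.baseCounit B h

/-! The eight idempotents: the images of `⊓^R_∘` under the composites of the transformations
`∘`, `•` and `∗`. -/

/-- The idempotent `⊓^R_∘` itself. -/
def sqcapRCirc : 𝐉 ⊚ A ⟶ 𝐉 ⊚ A := D.sqcap B

/-- Image of `⊓^R_∘` under `•`. -/
def sqcapBarLCirc : 𝐉 ⊚ A ⟶ 𝐉 ⊚ A := D.bulletRev.sqcap B.bulletRev

/-- Image of `⊓^R_∘` under `∘`. -/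
def sqcapBarRCirc : A ⊚ 𝐉 ⟶ A ⊚ 𝐉 := D.circRev.sqcap B.circRev

/-- Image of `⊓^R_∘` under `∘` and `•`. -/
def sqcapLCirc : A ⊚ 𝐉 ⟶ A ⊚ 𝐉 := D.circRev.bulletRev.sqcap B.circRev.bulletRev

/-- Image of `⊓^R_∘` under `∗`. -/
def sqcapRBullet : 𝐈 ⊛ A ⟶ 𝐈 ⊛ A := (D.op.sqcapRCirc B.op).unop

/-- Image of `⊓̄^L_∘` under `∗`. -/
def sqcapBarRBullet : 𝐈 ⊛ A ⟶ 𝐈 ⊛ A := (D.op.sqcapBarLCirc B.op).unop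

/-- Image of `⊓̄^R_∘` under `∗`. -/
def sqcapBarLBullet : A ⊛ 𝐈 ⟶ A ⊛ 𝐈 := (D.op.sqcapBarRCirc B.op).unop

/-- Image of `⊓^L_∘` under `∗`. -/
def sqcapLBullet : A ⊛ 𝐈 ⟶ A ⊛ 𝐈 := (D.op.sqcapLCirc B.op).unop

/-! The monoid and comonoid structures of the eight base objects. -/

def dataRCirc (h : Retract R (𝐉 ⊚ A)) : MonComonData bullet R := D.baseData B h

def dataBarLCirc (h : Retract R (𝐉 ⊚ A)) : MonComonData bullet R :=
  (D.bulletRev.baseData B.bulletRev h).unrev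

def dataBarRCirc (h : Retract R (A ⊚ 𝐉)) : MonComonData bullet R :=
  D.circRev.baseData B.circRev h

def dataLCirc (h : Retract R (A ⊚ 𝐉)) : MonComonData bullet R :=
  (D.circRev.bulletRev.baseData B.circRev.bulletRev h).unrev

def dataRBullet (h : Retract R (𝐈 ⊛ A)) : MonComonData circ R := (D.op.dataRCirc B.op h.op).unop

def dataBarRBullet (h : Retract R (𝐈 ⊛ A)) : MonComonData circ R :=
  (D.op.dataBarLCirc B.op h.op).unop

def dataBarLBullet (h : Retract R (A ⊛ 𝐈)) : MonComonData circ R :=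
  (D.op.dataBarRCirc B.op h.op).unop

def dataLBullet (h : Retract R (A ⊛ 𝐈)) : MonComonData circ R := (D.op.dataLCirc B.op h.op).unop

end DuoidalStructure

end Duoidal

/-- The retract `h` of `X` is a splitting of the endomorphism `e` of `X`. -/
def IsSplitting {C : Type u} [Category.{v} C] {R X : C} (h : Retract R X) (e : X ⟶ X) : Prop :=
  h.r ≫ h.i = e

end Duoidal

/-! A right weak bimonoid `A` makes `T = - ⊚ A` a monad on `(C, ⊛)` with an opmonoidal structure
satisfying the weak bimonad axioms (`weakBimonad`), so most of the argument takes place in one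
monoidal category. The counit axioms say that two endomorphisms `sqR`, `sqL` of `T 𝟙` cannot be
detected by the pairing `kappa = ε.μ`. Since `f ≫ sqR` and `f ≫ sqL` depend on `f` only through its
pairing `T f ≫ kappa`, whichever of the two comes second in a composite wins. Both are therefore
idempotent, and their splittings are the same quotient of `T 𝟙`, with two different sections. This
gives the isomorphism between the two base objects.

`IsBase` records what the two quotients share. Such a quotient `R` is a `T`-algebra, and a morphism
into it is determined by its pairing with `act ≫ eps` (`hom_ext`). The unit axioms say that `χ₁₂`
and `χ₂₃` commute on `R ⊗ R ⊗ R` (`chi_comm`). Coassociativity and the counit axioms say that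
killing, or inserting, either tensor factor of `χ` gives the same result (`compatibleEndo`). These
facts imply all the monoid and comonoid axioms (`CompatibleEndo`).

A comparison map between two such quotients is a `T`-algebra morphism that respects unit and counit.
As `χ` is natural in algebra morphisms, the map respects all the structure (`IsBase.isomorphic`).

The four pairs of base objects come from this one by symmetry. For the pairs over `𝐈`, the axioms
must be self-dual under `∗` (`isWeakBimonoid_op`). This holds only for the left and right axioms
together, because `∗` mixes them. -/

namespace Duoidal

/-! ### Monoids and comonoids from an endomorphism of `R ⊗ R` -/

section Abstract

open MonoidalCategory

/-- An endomorphism `χ` of `R ⊗ R` together with a point and a copoint of `R`, such that the two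
products and the two coproducts which they induce agree. -/
structure CompatibleEndo {C : Type u} [Category.{v} C] [MonoidalCategory C] {R : C}
    (χ : R ⊗ R ⟶ R ⊗ R) (one : 𝟙_ C ⟶ R) (eps : R ⟶ 𝟙_ C) : Prop where
  mul_eq : χ ≫ R ◁ eps ≫ (ρ_ R).hom = χ ≫ eps ▷ R ≫ (λ_ R).hom
  comul_eq : (ρ_ R).inv ≫ R ◁ one ≫ χ = (λ_ R).inv ≫ one ▷ R ≫ χ
  comm : χ ▷ R ≫ (α_ R R R).hom ≫ R ◁ χ =
    (α_ R R R).hom ≫ R ◁ χ ≫ (α_ R R R).inv ≫ χ ▷ R ≫ (α_ R R R).hom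
  right : (ρ_ R).inv ≫ R ◁ one ≫ χ ≫ R ◁ eps ≫ (ρ_ R).hom = 𝟙 R
  left : (λ_ R).inv ≫ one ▷ R ≫ χ ≫ eps ▷ R ≫ (λ_ R).hom = 𝟙 R

namespace CompatibleEndo

variable {C : Type u} [Category.{v} C] [MonoidalCategory C] {R : C}
  {χ : R ⊗ R ⟶ R ⊗ R} {one : 𝟙_ C ⟶ R} {eps : R ⟶ 𝟙_ C}

theorem one_mul (h : CompatibleEndo χ one eps) :
    one ▷ R ≫ χ ≫ R ◁ eps ≫ (ρ_ R).hom = (λ_ R).hom := by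
  rw [h.mul_eq, ← cancel_epi (λ_ R).inv, h.left, Iso.inv_hom_id]

theorem mul_one (h : CompatibleEndo χ one eps) :
    R ◁ one ≫ χ ≫ R ◁ eps ≫ (ρ_ R).hom = (ρ_ R).hom := by
  rw [← cancel_epi (ρ_ R).inv, h.right, Iso.inv_hom_id]

/-- By `mul_eq`, the counit in one of the two products may be applied on the left. Both bracketings
then become the two sides of `comm` with `eps` applied to the outer factors, leaving the middle one.
-/
theorem mul_assoc (h : CompatibleEndo χ one eps) :
    (χ ≫ R ◁ eps ≫ (ρ_ R).hom) ▷ R ≫ χ ≫ R ◁ eps ≫ (ρ_ R).hom =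
      (α_ R R R).hom ≫ R ◁ (χ ≫ R ◁ eps ≫ (ρ_ R).hom) ≫ χ ≫ R ◁ eps ≫ (ρ_ R).hom := by
  have e1 : (χ ≫ R ◁ eps ≫ (ρ_ R).hom) ▷ R ≫ χ ≫ R ◁ eps ≫ (ρ_ R).hom =
      (χ ▷ R ≫ (α_ R R R).hom ≫ R ◁ χ) ≫ (eps ⊗ₘ (R ◁ eps ≫ (ρ_ R).hom)) ≫ (λ_ R).hom := by
    have e : (eps ▷ R ≫ (λ_ R).hom) ▷ R = (α_ R R R).hom ≫ eps ▷ (R ⊗ R) ≫ (λ_ (R ⊗ R)).hom := by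
      simp
    conv_lhs => enter [1, 1]; rw [h.mul_eq]
    rw [MonoidalCategory.comp_whiskerRight, e, MonoidalCategory.tensorHom_def]
    simp only [Category.assoc, ← leftUnitor_naturality_assoc, whisker_exchange_assoc,
      MonoidalCategory.whiskerLeft_comp, leftUnitor_naturality]
  have e2 : R ◁ (χ ≫ R ◁ eps ≫ (ρ_ R).hom) ≫ χ ≫ R ◁ eps ≫ (ρ_ R).hom =
      (R ◁ χ ≫ (α_ R R R).inv ≫ χ ▷ R ≫ (α_ R R R).hom) ≫
        (eps ⊗ₘ (R ◁ eps ≫ (ρ_ R).hom)) ≫ (λ_ R).hom := by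
    have e : R ◁ (R ◁ eps ≫ (ρ_ R).hom) = (α_ R R R).inv ≫ (R ⊗ R) ◁ eps ≫ (ρ_ (R ⊗ R)).hom := by
      simp
    have e' : (R ⊗ R) ◁ eps ≫ (ρ_ (R ⊗ R)).hom ≫ eps ▷ R ≫ (λ_ R).hom =
        (α_ R R R).hom ≫ (eps ⊗ₘ (R ◁ eps ≫ (ρ_ R).hom)) ≫ (λ_ R).hom := by
      simp [tensorHom_def']
    rw [MonoidalCategory.whiskerLeft_comp, e, Category.assoc, h.mul_eq]
    simp only [Category.assoc, ← e', whisker_exchange_assoc, ← rightUnitor_naturality_assoc]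
  rw [e1, e2, h.comm]
  simp only [Category.assoc]

theorem counit_comul (h : CompatibleEndo χ one eps) :
    ((ρ_ R).inv ≫ R ◁ one ≫ χ) ≫ eps ▷ R = (λ_ R).inv := by
  rw [h.comul_eq, ← cancel_mono (λ_ R).hom, Iso.inv_hom_id, ← h.left]
  simp only [Category.assoc]

theorem comul_counit (h : CompatibleEndo χ one eps) :
    ((ρ_ R).inv ≫ R ◁ one ≫ χ) ≫ R ◁ eps = (ρ_ R).inv := by
  rw [← cancel_mono (ρ_ R).hom, Iso.inv_hom_id, ← h.right]
  simp only [Category.assoc]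

/-- Dual to associativity: by `comul_eq`, `R` can be placed in the middle with `one` inserted on
both sides, after which the two iterated coproducts are the two sides of `comm`. -/
theorem comul_assoc (h : CompatibleEndo χ one eps) :
    ((ρ_ R).inv ≫ R ◁ one ≫ χ) ≫ R ◁ ((ρ_ R).inv ≫ R ◁ one ≫ χ) =
      ((ρ_ R).inv ≫ R ◁ one ≫ χ) ≫ ((ρ_ R).inv ≫ R ◁ one ≫ χ) ▷ R ≫ (α_ R R R).hom := by
  have e1 : ((ρ_ R).inv ≫ R ◁ one ≫ χ) ≫ R ◁ ((ρ_ R).inv ≫ R ◁ one ≫ χ) =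
      ((ρ_ R).inv ≫ R ◁ one ≫ (λ_ (R ⊗ R)).inv ≫ one ▷ (R ⊗ R) ≫ (α_ R R R).inv) ≫
        (χ ▷ R ≫ (α_ R R R).hom ≫ R ◁ χ) := by
    have e : R ◁ ((ρ_ R).inv ≫ R ◁ one) = (ρ_ (R ⊗ R)).inv ≫ (R ⊗ R) ◁ one ≫ (α_ R R R).hom := by
      simp
    have e' : (λ_ R).inv ≫ one ▷ R ≫ (ρ_ (R ⊗ R)).inv ≫ (R ⊗ R) ◁ one =
        (ρ_ R).inv ≫ R ◁ one ≫ (λ_ (R ⊗ R)).inv ≫ one ▷ (R ⊗ R) ≫ (α_ R R R).inv := by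
      simp only [rightUnitor_inv_naturality_assoc, ← whisker_exchange]
      monoidal
    rw [← e']
    conv_lhs => enter [1]; rw [h.comul_eq]
    rw [← Category.assoc (ρ_ R).inv, MonoidalCategory.whiskerLeft_comp, e]
    simp only [Category.assoc, rightUnitor_inv_naturality_assoc, whisker_exchange_assoc,
      MonoidalCategory.comp_whiskerRight]
  have e2 : ((ρ_ R).inv ≫ R ◁ one ≫ χ) ≫ ((ρ_ R).inv ≫ R ◁ one ≫ χ) ▷ R ≫ (α_ R R R).hom =
      ((ρ_ R).inv ≫ R ◁ one ≫ (λ_ (R ⊗ R)).inv ≫ one ▷ (R ⊗ R) ≫ (α_ R R R).inv) ≫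
        ((α_ R R R).hom ≫ R ◁ χ ≫ (α_ R R R).inv ≫ χ ▷ R ≫ (α_ R R R).hom) := by
    have e : ((λ_ R).inv ≫ one ▷ R) ▷ R = (λ_ (R ⊗ R)).inv ≫ one ▷ (R ⊗ R) ≫ (α_ R R R).inv := by
      simp
    conv_lhs => enter [2, 1]; rw [h.comul_eq]
    rw [← Category.assoc (λ_ R).inv, MonoidalCategory.comp_whiskerRight, e]
    simp only [Category.assoc, leftUnitor_inv_naturality_assoc, ← whisker_exchange_assoc,
      MonoidalCategory.whiskerLeft_comp, Iso.inv_hom_id_assoc]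
  rw [e1, e2, h.comm]

end CompatibleEndo

/-! ### Weak bimonads and the two idempotents of `T 𝟙` -/

/-- A monad `T` with an opmonoidal structure, satisfying the axioms of a weak bimonad on the unit
of `T` and on the counit. The compatibility of the multiplication of `T` with the opmonoidal
structure is not needed for the construction of the base objects, and not part of the structure. -/
structure WeakBimonad (C : Type u) [Category.{v} C] [MonoidalCategory C] where
  T : C ⥤ C
  unit (X : C) : X ⟶ T.obj X
  mult (X : C) : T.obj (T.obj X) ⟶ T.obj X
  comul (X Y : C) : T.obj (X ⊗ Y) ⟶ T.obj X ⊗ T.obj Y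
  counit : T.obj (𝟙_ C) ⟶ 𝟙_ C
  unit_natural {X Y : C} (f : X ⟶ Y) : f ≫ unit Y = unit X ≫ T.map f
  mult_natural {X Y : C} (f : X ⟶ Y) : T.map (T.map f) ≫ mult Y = mult X ≫ T.map f
  unit_mult (X : C) : unit (T.obj X) ≫ mult X = 𝟙 (T.obj X)
  map_unit_mult (X : C) : T.map (unit X) ≫ mult X = 𝟙 (T.obj X)
  mult_assoc (X : C) : T.map (mult X) ≫ mult X = mult (T.obj X) ≫ mult X
  comul_natural {X Y X' Y' : C} (f : X ⟶ X') (g : Y ⟶ Y') :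
    T.map (f ⊗ₘ g) ≫ comul X' Y' = comul X Y ≫ (T.map f ⊗ₘ T.map g)
  comul_assoc (X Y Z : C) :
    comul (X ⊗ Y) Z ≫ comul X Y ▷ T.obj Z ≫ (α_ _ _ _).hom =
      T.map (α_ X Y Z).hom ≫ comul X (Y ⊗ Z) ≫ T.obj X ◁ comul Y Z
  counit_comul (X : C) :
    T.map (λ_ X).inv ≫ comul (𝟙_ C) X ≫ counit ▷ T.obj X = (λ_ (T.obj X)).inv
  comul_counit (X : C) :
    T.map (ρ_ X).inv ≫ comul X (𝟙_ C) ≫ T.obj X ◁ counit = (ρ_ (T.obj X)).inv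
  unit_comul_left (X Y Z : C) :
    (unit (X ⊗ Y) ≫ comul X Y) ▷ Z ≫ (α_ _ _ _).hom ≫
        T.obj X ◁ (unit (T.obj Y ⊗ Z) ≫ comul (T.obj Y) Z ≫ mult Y ▷ T.obj Z) =
      (α_ X Y Z).hom ≫ unit (X ⊗ (Y ⊗ Z)) ≫ comul X (Y ⊗ Z) ≫ T.obj X ◁ comul Y Z
  unit_comul_right (X Y Z : C) :
    X ◁ (unit (Y ⊗ Z) ≫ comul Y Z) ≫ (α_ _ _ _).inv ≫
        (unit (X ⊗ T.obj Y) ≫ comul X (T.obj Y) ≫ T.obj X ◁ mult Y) ▷ T.obj Z =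
      unit (X ⊗ (Y ⊗ Z)) ≫ comul X (Y ⊗ Z) ≫ T.obj X ◁ comul Y Z ≫ (α_ _ _ _).inv
  counit_mult_right :
    T.map (T.map (λ_ (T.obj (𝟙_ C))).inv ≫ comul (𝟙_ C) (T.obj (𝟙_ C)) ≫
        T.obj (𝟙_ C) ◁ (mult (𝟙_ C) ≫ counit) ≫ (ρ_ _).hom) ≫ mult (𝟙_ C) ≫ counit =
      T.map (mult (𝟙_ C)) ≫ mult (𝟙_ C) ≫ counit
  counit_mult_left :
    T.map (T.map (ρ_ (T.obj (𝟙_ C))).inv ≫ comul (T.obj (𝟙_ C)) (𝟙_ C) ≫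
        (mult (𝟙_ C) ≫ counit) ▷ T.obj (𝟙_ C) ≫ (λ_ _).hom) ≫ mult (𝟙_ C) ≫ counit =
      T.map (mult (𝟙_ C)) ≫ mult (𝟙_ C) ≫ counit

namespace WeakBimonad

variable {C : Type u} [Category.{v} C] [MonoidalCategory C] (W : WeakBimonad C)

/-- The morphism `T X ⟶ T 𝟙` obtained by applying `k` to the second coproduct factor. -/
def actR {X : C} (k : W.T.obj X ⟶ 𝟙_ C) : W.T.obj X ⟶ W.T.obj (𝟙_ C) :=
  W.T.map (λ_ X).inv ≫ W.comul (𝟙_ C) X ≫ W.T.obj (𝟙_ C) ◁ k ≫ (ρ_ _).hom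

/-- The morphism `T X ⟶ T 𝟙` obtained by applying `k` to the first coproduct factor. -/
def actL {X : C} (k : W.T.obj X ⟶ 𝟙_ C) : W.T.obj X ⟶ W.T.obj (𝟙_ C) :=
  W.T.map (ρ_ X).inv ≫ W.comul X (𝟙_ C) ≫ k ▷ W.T.obj (𝟙_ C) ≫ (λ_ _).hom

def kappa : W.T.obj (W.T.obj (𝟙_ C)) ⟶ 𝟙_ C := W.mult (𝟙_ C) ≫ W.counit

def sqR : W.T.obj (𝟙_ C) ⟶ W.T.obj (𝟙_ C) := W.unit _ ≫ W.actR W.kappa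

def sqL : W.T.obj (𝟙_ C) ⟶ W.T.obj (𝟙_ C) := W.unit _ ≫ W.actL W.kappa

theorem map_actR {X Y : C} (f : X ⟶ Y) (k : W.T.obj Y ⟶ 𝟙_ C) :
    W.T.map f ≫ W.actR k = W.actR (W.T.map f ≫ k) := by
  have h := W.comul_natural (𝟙 (𝟙_ C)) f
  rw [id_tensorHom, CategoryTheory.Functor.map_id, id_tensorHom] at h
  simp only [actR, ← W.T.map_comp_assoc, leftUnitor_inv_naturality]
  simp only [W.T.map_comp, Category.assoc, reassoc_of% h, MonoidalCategory.whiskerLeft_comp]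

theorem map_actL {X Y : C} (f : X ⟶ Y) (k : W.T.obj Y ⟶ 𝟙_ C) :
    W.T.map f ≫ W.actL k = W.actL (W.T.map f ≫ k) := by
  have h := W.comul_natural f (𝟙 (𝟙_ C))
  rw [tensorHom_id, CategoryTheory.Functor.map_id, tensorHom_id] at h
  simp only [actL, ← W.T.map_comp_assoc, rightUnitor_inv_naturality]
  simp only [W.T.map_comp, Category.assoc, reassoc_of% h, MonoidalCategory.comp_whiskerRight]

theorem actR_counit {X : C} (k : W.T.obj X ⟶ 𝟙_ C) : W.actR k ≫ W.counit = k := by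
  have : W.actR k ≫ W.counit = (W.T.map (λ_ X).inv ≫ W.comul (𝟙_ C) X ≫ W.counit ▷ W.T.obj X) ≫
      𝟙_ C ◁ k ≫ (λ_ _).hom := by
    simp only [actR, Category.assoc, ← rightUnitor_naturality, whisker_exchange_assoc,
      unitors_equal]
  rw [this, W.counit_comul, leftUnitor_naturality, Iso.inv_hom_id_assoc]

theorem actL_counit {X : C} (k : W.T.obj X ⟶ 𝟙_ C) : W.actL k ≫ W.counit = k := by
  have : W.actL k ≫ W.counit = (W.T.map (ρ_ X).inv ≫ W.comul X (𝟙_ C) ≫ W.T.obj X ◁ W.counit) ≫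
      k ▷ 𝟙_ C ≫ (ρ_ _).hom := by
    simp only [actL, Category.assoc, ← leftUnitor_naturality, ← whisker_exchange_assoc,
      unitors_equal]
  rw [this, W.comul_counit, rightUnitor_naturality, Iso.inv_hom_id_assoc]

/-- By coassociativity, both sides are the threefold coproduct into `T X ⊗ T 𝟙 ⊗ T Y` with `k` and
`l` applied to the outer factors. -/
theorem comul_actL_actR {X Y : C} (k : W.T.obj X ⟶ 𝟙_ C) (l : W.T.obj Y ⟶ 𝟙_ C) :
    W.comul X Y ≫ (W.actL k ⊗ₘ l) ≫ (ρ_ _).hom = W.comul X Y ≫ (k ⊗ₘ W.actR l) ≫ (λ_ _).hom := by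
  have h1 := W.comul_natural (ρ_ X).inv (𝟙 Y)
  have h2 := W.comul_natural (𝟙 X) (λ_ Y).inv
  have h3 := W.comul_assoc X (𝟙_ C) Y
  rw [tensorHom_id, CategoryTheory.Functor.map_id, tensorHom_id] at h1
  rw [id_tensorHom, CategoryTheory.Functor.map_id, id_tensorHom] at h2
  have e1 : W.comul X Y ≫ (W.actL k ⊗ₘ l) ≫ (ρ_ _).hom =
      W.T.map ((ρ_ X).inv ▷ Y) ≫ (W.comul (X ⊗ 𝟙_ C) Y ≫ W.comul X (𝟙_ C) ▷ W.T.obj Y ≫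
        (α_ _ _ _).hom) ≫ (k ⊗ₘ W.T.obj (𝟙_ C) ◁ l ≫ (ρ_ _).hom) ≫ (λ_ _).hom := by
    simp only [← Category.assoc, h1]
    simp only [actL, Category.assoc]
    simp only [MonoidalCategory.tensorHom_def]
    monoidal
  have e2 : W.comul X Y ≫ (k ⊗ₘ W.actR l) ≫ (λ_ _).hom =
      W.T.map (X ◁ (λ_ Y).inv) ≫ (W.comul X (𝟙_ C ⊗ Y) ≫ W.T.obj X ◁ W.comul (𝟙_ C) Y) ≫
        (k ⊗ₘ W.T.obj (𝟙_ C) ◁ l ≫ (ρ_ _).hom) ≫ (λ_ _).hom := by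
    simp only [← Category.assoc, h2]
    simp only [actR, Category.assoc]
    simp only [tensorHom_def']
    monoidal
  rw [e1, e2, h3, Category.assoc, ← W.T.map_comp_assoc]
  simp

/-- By coassociativity, both sides are the threefold coproduct into `T 𝟙 ⊗ T X ⊗ T 𝟙` with `k`
applied to the middle factor. -/
theorem comul_actR_actL {X : C} (k : W.T.obj X ⟶ 𝟙_ C) :
    W.T.map (ρ_ X).inv ≫ W.comul X (𝟙_ C) ≫ W.actR k ▷ _ =
      W.T.map (λ_ X).inv ≫ W.comul (𝟙_ C) X ≫ _ ◁ W.actL k := by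
  have h1 := W.comul_natural (λ_ X).inv (𝟙 (𝟙_ C))
  have h2 := W.comul_natural (𝟙 (𝟙_ C)) (ρ_ X).inv
  have h3 := W.comul_assoc (𝟙_ C) X (𝟙_ C)
  rw [tensorHom_id, CategoryTheory.Functor.map_id, tensorHom_id] at h1
  rw [id_tensorHom, CategoryTheory.Functor.map_id, id_tensorHom] at h2
  have e1 : W.comul X (𝟙_ C) ≫ W.actR k ▷ _ =
      W.T.map ((λ_ X).inv ▷ 𝟙_ C) ≫ (W.comul (𝟙_ C ⊗ X) (𝟙_ C) ≫
        W.comul (𝟙_ C) X ▷ W.T.obj (𝟙_ C) ≫ (α_ _ _ _).hom) ≫ _ ◁ (k ▷ _ ≫ (λ_ _).hom) := by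
    simp only [← Category.assoc, h1]
    simp only [actR, Category.assoc]
    simp
  have e2 : W.comul (𝟙_ C) X ≫ _ ◁ W.actL k =
      W.T.map (𝟙_ C ◁ (ρ_ X).inv) ≫ (W.comul (𝟙_ C) (X ⊗ 𝟙_ C) ≫
        W.T.obj (𝟙_ C) ◁ W.comul X (𝟙_ C)) ≫ _ ◁ (k ▷ _ ≫ (λ_ _).hom) := by
    simp only [← Category.assoc, h2]
    simp only [actL, Category.assoc]
    simp
  rw [e1, e2, h3, Category.assoc, ← W.T.map_comp_assoc, ← W.T.map_comp_assoc,
    ← W.T.map_comp_assoc]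
  congr 2
  simp

/-- This is the counit axiom preceded by `T` of the unit, which cancels the multiplication on the
other side. -/
theorem map_sqR_kappa : W.T.map W.sqR ≫ W.kappa = W.kappa := by
  have h := W.counit_mult_right
  change W.T.map (W.actR W.kappa) ≫ W.kappa = W.T.map (W.mult _) ≫ W.kappa at h
  rw [sqR, W.T.map_comp, Category.assoc, h, ← W.T.map_comp_assoc, W.unit_mult, W.T.map_id,
    Category.id_comp]

theorem map_sqL_kappa : W.T.map W.sqL ≫ W.kappa = W.kappa := by
  have h := W.counit_mult_left
  change W.T.map (W.actL W.kappa) ≫ W.kappa = W.T.map (W.mult _) ≫ W.kappa at h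
  rw [sqL, W.T.map_comp, Category.assoc, h, ← W.T.map_comp_assoc, W.unit_mult, W.T.map_id,
    Category.id_comp]

/-- The right side involves `f` only through its pairing under `kappa`. All relations between `sqR`
and `sqL` follow from this and from their invisibility to `kappa`. -/
theorem comp_sqR {X : C} (f : X ⟶ W.T.obj (𝟙_ C)) :
    f ≫ W.sqR = W.unit X ≫ W.actR (W.T.map f ≫ W.kappa) := by
  rw [sqR, ← Category.assoc, W.unit_natural, Category.assoc, map_actR]

theorem comp_sqL {X : C} (f : X ⟶ W.T.obj (𝟙_ C)) :
    f ≫ W.sqL = W.unit X ≫ W.actL (W.T.map f ≫ W.kappa) := by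
  rw [sqL, ← Category.assoc, W.unit_natural, Category.assoc, map_actL]

theorem sqR_sqR : W.sqR ≫ W.sqR = W.sqR := by
  rw [comp_sqR, map_sqR_kappa, ← sqR]

theorem sqL_sqR : W.sqL ≫ W.sqR = W.sqR := by
  rw [comp_sqR, map_sqL_kappa, ← sqR]

theorem sqR_sqL : W.sqR ≫ W.sqL = W.sqL := by
  rw [comp_sqL, map_sqR_kappa, ← sqL]

theorem sqL_sqL : W.sqL ≫ W.sqL = W.sqL := by
  rw [comp_sqL, map_sqL_kappa, ← sqL]

/-- Associativity and naturality of the multiplication move `f` inside `kappa`, where it disappears.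
This is what lets the free action descend along the idempotents. -/
theorem map_map_mult_kappa {f : W.T.obj (𝟙_ C) ⟶ W.T.obj (𝟙_ C)}
    (hf : W.T.map f ≫ W.kappa = W.kappa) :
    W.T.map (W.T.map f ≫ W.mult _) ≫ W.kappa = W.T.map (W.mult _) ≫ W.kappa := by
  have h : W.T.map (W.mult _) ≫ W.kappa = W.mult _ ≫ W.kappa := by
    rw [kappa, ← Category.assoc, W.mult_assoc, Category.assoc]
  rw [W.T.map_comp, Category.assoc, h, ← Category.assoc, W.mult_natural, Category.assoc, hf]

theorem sqR_counit : W.sqR ≫ W.counit = W.counit := by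
  rw [sqR, Category.assoc, actR_counit, kappa, ← Category.assoc, W.unit_mult, Category.id_comp]

theorem sqL_counit : W.sqL ≫ W.counit = W.counit := by
  rw [sqL, Category.assoc, actL_counit, kappa, ← Category.assoc, W.unit_mult, Category.id_comp]

/-! ### Base objects as quotients of the free algebra `T 𝟙` -/

/-- Retracts of `T 𝟙` which are quotients of the free algebra with the properties of the base
objects. -/
structure IsBase {R : C} (h : Retract R (W.T.obj (𝟙_ C))) : Prop where
  sqR_r : W.sqR ≫ h.r = h.r
  sqL_r : W.sqL ≫ h.r = h.r
  mult_r : W.T.map (h.r ≫ h.i) ≫ W.mult _ ≫ h.r = W.mult _ ≫ h.r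
  r_counit : h.r ≫ h.i ≫ W.counit = W.counit

variable {W} {R S : C} {h : Retract R (W.T.obj (𝟙_ C))} {k : Retract S (W.T.obj (𝟙_ C))}

theorem isBase_of_sqR (hh : h.r ≫ h.i = W.sqR) : W.IsBase h where
  sqR_r := by rw [← hh, Category.assoc, h.retract, Category.comp_id]
  sqL_r := by
    have : Mono h.i := ⟨fun a b e => by simpa using e =≫ h.r⟩
    rw [← cancel_mono h.i, Category.assoc, hh, sqL_sqR]
  mult_r := by
    have : Mono h.i := ⟨fun a b e => by simpa using e =≫ h.r⟩
    rw [← cancel_mono h.i]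
    simp only [Category.assoc, hh]
    rw [← Category.assoc, comp_sqR, comp_sqR, W.map_map_mult_kappa W.map_sqR_kappa]
  r_counit := by rw [← Category.assoc, hh, sqR_counit]

theorem isBase_of_sqL (hh : h.r ≫ h.i = W.sqL) : W.IsBase h where
  sqL_r := by rw [← hh, Category.assoc, h.retract, Category.comp_id]
  sqR_r := by
    have : Mono h.i := ⟨fun a b e => by simpa using e =≫ h.r⟩
    rw [← cancel_mono h.i, Category.assoc, hh, sqR_sqL]
  mult_r := by
    have : Mono h.i := ⟨fun a b e => by simpa using e =≫ h.r⟩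
    rw [← cancel_mono h.i]
    simp only [Category.assoc, hh]
    rw [← Category.assoc, comp_sqL, comp_sqL, W.map_map_mult_kappa W.map_sqL_kappa]
  r_counit := by rw [← Category.assoc, hh, sqL_counit]

variable (W h)

def act : W.T.obj R ⟶ R := W.T.map h.i ≫ W.mult _ ≫ h.r

def one : 𝟙_ C ⟶ R := W.unit _ ≫ h.r

def eps : R ⟶ 𝟙_ C := h.i ≫ W.counit

/-- The endomorphism of the product of two algebras. -/
def chi {F G : C} (φ : W.T.obj F ⟶ F) (γ : W.T.obj G ⟶ G) : F ⊗ G ⟶ F ⊗ G :=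
  W.unit _ ≫ W.comul F G ≫ (φ ⊗ₘ γ)

variable {W h}

namespace IsBase

/-- The projection is an algebra morphism from the free algebra, although the section `h.i` used to
define the action need not be one. -/
theorem map_r_act (hh : W.IsBase h) : W.T.map h.r ≫ W.act h = W.mult _ ≫ h.r := by
  rw [act, ← W.T.map_comp_assoc, hh.mult_r]

theorem r_eps (hh : W.IsBase h) : h.r ≫ W.eps h = W.counit := hh.r_counit

theorem map_one_act (hh : W.IsBase h) : W.T.map (W.one h) ≫ W.act h = h.r := by
  rw [one, W.T.map_comp, Category.assoc, hh.map_r_act, ← Category.assoc, W.map_unit_mult,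
    Category.id_comp]

theorem unit_act : W.unit R ≫ W.act h = 𝟙 R := by
  rw [act, ← Category.assoc, ← W.unit_natural, Category.assoc]
  rw [← Category.assoc (W.unit _), W.unit_mult, Category.id_comp, h.retract]

theorem map_act_act (hh : W.IsBase h) : W.T.map (W.act h) ≫ W.act h = W.mult R ≫ W.act h := by
  have e : W.T.map (W.act h) = W.T.map (W.T.map h.i) ≫ W.T.map (W.mult _) ≫ W.T.map h.r := by
    simp only [act, W.T.map_comp]
  rw [e, Category.assoc, Category.assoc, hh.map_r_act,
    ← Category.assoc (W.T.map (W.mult _)), W.mult_assoc, Category.assoc,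
    ← Category.assoc, W.mult_natural, Category.assoc, act]

theorem map_r_act_eps (hh : W.IsBase h) : W.T.map h.r ≫ W.act h ≫ W.eps h = W.kappa := by
  rw [← Category.assoc, hh.map_r_act, Category.assoc, hh.r_eps, kappa]

/-- Nondegeneracy of the pairing `act ≫ eps`. For `f` the identity, precompose with the split
epimorphism `h.r`: the formula becomes `sqR ≫ h.r = h.r`. Naturality gives the general case. -/
theorem separate_right (hh : W.IsBase h) {X : C} (f : X ⟶ R) :
    W.unit X ≫ W.actR (W.T.map f ≫ W.act h ≫ W.eps h) ≫ h.r = f := by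
  have : W.unit R ≫ W.actR (W.act h ≫ W.eps h) ≫ h.r = 𝟙 R := by
    have e : h.r ≫ W.unit R ≫ W.actR (W.act h ≫ W.eps h) ≫ h.r = h.r := by
      rw [← Category.assoc, W.unit_natural, Category.assoc, ← Category.assoc (W.T.map _),
        map_actR, hh.map_r_act_eps, ← Category.assoc, ← sqR, hh.sqR_r]
    simpa using h.i ≫= e
  rw [← map_actR, Category.assoc, ← Category.assoc, ← W.unit_natural, Category.assoc, this,
    Category.comp_id]

theorem hom_ext (hh : W.IsBase h) {X : C} {f g : X ⟶ R}
    (e : W.T.map f ≫ W.act h ≫ W.eps h = W.T.map g ≫ W.act h ≫ W.eps h) : f = g := by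
  rw [← hh.separate_right f, e, hh.separate_right]

/-- The action is recovered from the functional `act ≫ eps`. Tested against the pairing and pulled
back along the split epimorphism `T (T h.r)`, the equation is the axiom `counit_mult_right`. -/
theorem actR_r (hh : W.IsBase h) : W.actR (W.act h ≫ W.eps h) ≫ h.r = W.act h := by
  apply hh.hom_ext
  have : W.T.map (W.T.map h.r) ≫ W.T.map (W.actR (W.act h ≫ W.eps h) ≫ h.r) ≫
      W.act h ≫ W.eps h = W.T.map (W.T.map h.r) ≫ W.T.map (W.act h) ≫ W.act h ≫ W.eps h := by
    rw [← W.T.map_comp_assoc, ← W.T.map_comp_assoc, ← Category.assoc (W.T.map h.r), map_actR,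
      hh.map_r_act_eps, W.T.map_comp, Category.assoc, hh.map_r_act_eps, hh.map_r_act,
      W.T.map_comp, Category.assoc, hh.map_r_act_eps]
    exact W.counit_mult_right
  have e := W.T.map (W.T.map h.i) ≫= this
  simpa only [← W.T.map_comp_assoc, h.retract, W.T.map_id, Category.id_comp] using e

theorem actL_r (hh : W.IsBase h) : W.actL (W.act h ≫ W.eps h) ≫ h.r = W.act h := by
  apply hh.hom_ext
  have : W.T.map (W.T.map h.r) ≫ W.T.map (W.actL (W.act h ≫ W.eps h) ≫ h.r) ≫
      W.act h ≫ W.eps h = W.T.map (W.T.map h.r) ≫ W.T.map (W.act h) ≫ W.act h ≫ W.eps h := by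
    rw [← W.T.map_comp_assoc, ← W.T.map_comp_assoc, ← Category.assoc (W.T.map h.r), map_actL,
      hh.map_r_act_eps, W.T.map_comp, Category.assoc, hh.map_r_act_eps, hh.map_r_act,
      W.T.map_comp, Category.assoc, hh.map_r_act_eps]
    exact W.counit_mult_left
  have e := W.T.map (W.T.map h.i) ≫= this
  simpa only [← W.T.map_comp_assoc, h.retract, W.T.map_id, Category.id_comp] using e

theorem chi_comp_eps_right {F : C} (φ : W.T.obj F ⟶ F) :
    W.chi φ (W.act h) ≫ F ◁ W.eps h ≫ (ρ_ F).hom =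
      W.unit _ ≫ W.comul F R ≫ (φ ⊗ₘ (W.act h ≫ W.eps h)) ≫ (ρ_ F).hom := by
  simp only [chi, Category.assoc, ← id_tensorHom, tensorHom_comp_tensorHom_assoc,
    Category.comp_id]

theorem chi_comp_eps_left {F : C} (φ : W.T.obj F ⟶ F) :
    W.chi (W.act h) φ ≫ W.eps h ▷ F ≫ (λ_ F).hom =
      W.unit _ ≫ W.comul R F ≫ ((W.act h ≫ W.eps h) ⊗ₘ φ) ≫ (λ_ F).hom := by
  simp only [chi, Category.assoc, ← tensorHom_id, tensorHom_comp_tensorHom_assoc,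
    Category.comp_id]

theorem one_right_comp_chi (hh : W.IsBase h) {F : C} (φ : W.T.obj F ⟶ F) :
    (ρ_ F).inv ≫ F ◁ W.one h ≫ W.chi φ (W.act h) =
      W.unit F ≫ W.T.map (ρ_ F).inv ≫ W.comul F (𝟙_ C) ≫ (φ ⊗ₘ h.r) := by
  have e := W.comul_natural (𝟙 F) (W.one h)
  rw [id_tensorHom, W.T.map_id] at e
  rw [chi, ← Category.assoc (F ◁ W.one h), W.unit_natural, Category.assoc, reassoc_of% e,
    tensorHom_comp_tensorHom, hh.map_one_act, Category.id_comp, ← Category.assoc,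
    W.unit_natural, Category.assoc]

theorem one_left_comp_chi (hh : W.IsBase h) {F : C} (φ : W.T.obj F ⟶ F) :
    (λ_ F).inv ≫ W.one h ▷ F ≫ W.chi (W.act h) φ =
      W.unit F ≫ W.T.map (λ_ F).inv ≫ W.comul (𝟙_ C) F ≫ (h.r ⊗ₘ φ) := by
  have e := W.comul_natural (W.one h) (𝟙 F)
  rw [tensorHom_id, W.T.map_id] at e
  rw [chi, ← Category.assoc (W.one h ▷ F), W.unit_natural, Category.assoc, reassoc_of% e,
    tensorHom_comp_tensorHom, hh.map_one_act, Category.id_comp, ← Category.assoc,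
    W.unit_natural, Category.assoc]

/-- Associativity of the action collects all actions at the end. The unit axioms `unit_comul_left`
and `unit_comul_right` then turn either order of `χ₁₂` and `χ₂₃` into the twofold coproduct of the
unit followed by three actions. -/
theorem chi_comm (hh : W.IsBase h) :
    W.chi (W.act h) (W.act h) ▷ R ≫ (α_ R R R).hom ≫ R ◁ W.chi (W.act h) (W.act h) =
      (α_ R R R).hom ≫ R ◁ W.chi (W.act h) (W.act h) ≫ (α_ R R R).inv ≫
        W.chi (W.act h) (W.act h) ▷ R ≫ (α_ R R R).hom := by
  have h1 : W.chi (W.act h) (W.act h) ▷ R ≫ (α_ R R R).hom ≫ R ◁ W.chi (W.act h) (W.act h) =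
      ((W.unit (R ⊗ R) ≫ W.comul R R) ▷ R ≫ (α_ _ _ _).hom ≫
        W.T.obj R ◁ (W.unit (W.T.obj R ⊗ R) ≫ W.comul (W.T.obj R) R ≫ W.mult R ▷ W.T.obj R)) ≫
        (W.act h ⊗ₘ (W.act h ⊗ₘ W.act h)) := by
    have e : W.act h ▷ R ≫ W.chi (W.act h) (W.act h) =
        W.unit (W.T.obj R ⊗ R) ≫ W.comul (W.T.obj R) R ≫ W.mult R ▷ W.T.obj R ≫
          (W.act h ⊗ₘ W.act h) := by
      have e := W.comul_natural (W.act h) (𝟙 R)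
      rw [tensorHom_id, W.T.map_id] at e
      rw [chi, ← Category.assoc (W.act h ▷ R), W.unit_natural, Category.assoc, reassoc_of% e,
        tensorHom_comp_tensorHom, hh.map_act_act, ← tensorHom_id, tensorHom_comp_tensorHom]
    have e2 : (W.act h ⊗ₘ W.act h) ▷ R ≫ (α_ R R R).hom = (α_ _ _ _).hom ≫
        (W.T.obj R ◁ W.act h ▷ R) ≫ W.act h ▷ (R ⊗ R) := by
      simp [tensorHom_def']
    conv_lhs => enter [1]; rw [chi]
    simp only [MonoidalCategory.comp_whiskerRight, Category.assoc, reassoc_of% e2,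
      ← whisker_exchange]
    simp only [← MonoidalCategory.whiskerLeft_comp_assoc, e]
    simp only [Category.assoc, MonoidalCategory.whiskerLeft_comp, tensorHom_def']
  have h2 : R ◁ W.chi (W.act h) (W.act h) ≫ (α_ R R R).inv ≫ W.chi (W.act h) (W.act h) ▷ R =
      (R ◁ (W.unit (R ⊗ R) ≫ W.comul R R) ≫ (α_ _ _ _).inv ≫
        (W.unit (R ⊗ W.T.obj R) ≫ W.comul R (W.T.obj R) ≫ W.T.obj R ◁ W.mult R) ▷ W.T.obj R) ≫
        ((W.act h ⊗ₘ W.act h) ⊗ₘ W.act h) := by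
    have e : R ◁ W.act h ≫ W.chi (W.act h) (W.act h) =
        W.unit (R ⊗ W.T.obj R) ≫ W.comul R (W.T.obj R) ≫ W.T.obj R ◁ W.mult R ≫
          (W.act h ⊗ₘ W.act h) := by
      have e := W.comul_natural (𝟙 R) (W.act h)
      rw [id_tensorHom, W.T.map_id] at e
      rw [chi, ← Category.assoc (R ◁ W.act h), W.unit_natural, Category.assoc, reassoc_of% e,
        tensorHom_comp_tensorHom, hh.map_act_act, ← id_tensorHom, tensorHom_comp_tensorHom]
    have e2 : R ◁ (W.act h ⊗ₘ W.act h) ≫ (α_ R R R).inv = (α_ _ _ _).inv ≫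
        (R ◁ W.act h) ▷ W.T.obj R ≫ (R ⊗ R) ◁ W.act h := by
      simp [MonoidalCategory.tensorHom_def]
    conv_lhs => enter [1]; rw [chi]
    simp only [MonoidalCategory.whiskerLeft_comp, Category.assoc, reassoc_of% e2,
      whisker_exchange]
    simp only [← MonoidalCategory.comp_whiskerRight_assoc, e]
    simp only [Category.assoc, MonoidalCategory.comp_whiskerRight, MonoidalCategory.tensorHom_def]
  rw [h1, W.unit_comul_left]
  rw [reassoc_of% h2, ← Category.assoc (R ◁ _), ← Category.assoc (R ◁ _ ≫ _),
    Category.assoc (R ◁ _), W.unit_comul_right]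
  simp

theorem compatibleEndo (hh : W.IsBase h) :
    CompatibleEndo (W.chi (W.act h) (W.act h)) (W.one h) (W.eps h) where
  mul_eq := by
    rw [chi_comp_eps_right, chi_comp_eps_left]
    -- Writing the surviving action through `actL` on one side and through `actR` on the other
    -- reduces the claim to coassociativity.
    have e := W.comul_actL_actR (W.act h ≫ W.eps h) (W.act h ≫ W.eps h)
    have e1 : (W.act h ⊗ₘ (W.act h ≫ W.eps h)) ≫ (ρ_ R).hom =
        (W.actL (W.act h ≫ W.eps h) ⊗ₘ (W.act h ≫ W.eps h)) ≫ (ρ_ _).hom ≫ h.r := by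
      conv_lhs => enter [1, 1]; rw [← hh.actL_r]
      rw [← rightUnitor_naturality, ← tensorHom_id, tensorHom_comp_tensorHom_assoc,
        Category.comp_id]
    have e2 : ((W.act h ≫ W.eps h) ⊗ₘ W.act h) ≫ (λ_ R).hom =
        ((W.act h ≫ W.eps h) ⊗ₘ W.actR (W.act h ≫ W.eps h)) ≫ (λ_ _).hom ≫ h.r := by
      conv_lhs => enter [1, 2]; rw [← hh.actR_r]
      rw [← leftUnitor_naturality, ← id_tensorHom, tensorHom_comp_tensorHom_assoc,
        Category.comp_id]
    rw [e1, e2, reassoc_of% e]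
  comul_eq := by
    rw [hh.one_right_comp_chi, hh.one_left_comp_chi]
    have e := W.comul_actR_actL (W.act h ≫ W.eps h)
    have e1 : W.act h ⊗ₘ h.r = W.actR (W.act h ≫ W.eps h) ▷ _ ≫ (h.r ⊗ₘ h.r) := by
      conv_lhs => enter [1]; rw [← hh.actR_r]
      rw [← tensorHom_id, tensorHom_comp_tensorHom, Category.id_comp]
    have e2 : h.r ⊗ₘ W.act h = _ ◁ W.actL (W.act h ≫ W.eps h) ≫ (h.r ⊗ₘ h.r) := by
      conv_lhs => enter [2]; rw [← hh.actL_r]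
      rw [← id_tensorHom, tensorHom_comp_tensorHom, Category.id_comp]
    rw [e1, e2, reassoc_of% e]
  comm := hh.chi_comm
  right := by
    have e := hh.one_right_comp_chi (W.act h)
    have e1 : (W.act h ⊗ₘ h.r) ≫ R ◁ W.eps h ≫ (ρ_ R).hom =
        _ ◁ W.counit ≫ (ρ_ _).hom ≫ W.act h := by
      rw [← rightUnitor_naturality, ← id_tensorHom, tensorHom_comp_tensorHom_assoc, hh.r_eps,
        tensorHom_def']
      simp
    rw [reassoc_of% e, e1, reassoc_of% W.comul_counit, Iso.inv_hom_id_assoc, unit_act]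
  left := by
    have e := hh.one_left_comp_chi (W.act h)
    have e1 : (h.r ⊗ₘ W.act h) ≫ W.eps h ▷ R ≫ (λ_ R).hom =
        W.counit ▷ _ ≫ (λ_ _).hom ≫ W.act h := by
      rw [← leftUnitor_naturality, ← tensorHom_id, tensorHom_comp_tensorHom_assoc, hh.r_eps,
        MonoidalCategory.tensorHom_def]
      simp
    rw [reassoc_of% e, e1, reassoc_of% W.counit_comul, Iso.inv_hom_id_assoc, unit_act]

/-- By `e`, the comparison `h.i ≫ k.r` is the factorisation of `k.r` through `h.r`. Both projections
are algebra morphisms and `T h.r` is split epi, so the comparison is one too. -/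
theorem map_comp_act (hh : W.IsBase h) (hk : W.IsBase k) (e : h.r ≫ h.i ≫ k.r = k.r) :
    W.act h ≫ h.i ≫ k.r = W.T.map (h.i ≫ k.r) ≫ W.act k := by
  have : W.T.map h.r ≫ W.act h ≫ h.i ≫ k.r = W.T.map h.r ≫ W.T.map (h.i ≫ k.r) ≫ W.act k := by
    rw [← Category.assoc, hh.map_r_act, Category.assoc, e, ← W.T.map_comp_assoc, e, hk.map_r_act]
  have e' := W.T.map h.i ≫= this
  rw [← W.T.map_comp_assoc, ← W.T.map_comp_assoc, h.retract, W.T.map_id, Category.id_comp] at e'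
  rw [e', Category.id_comp]

theorem chi_comp (hh : W.IsBase h) (hk : W.IsBase k) (e : h.r ≫ h.i ≫ k.r = k.r) :
    W.chi (W.act h) (W.act h) ≫ ((h.i ≫ k.r) ⊗ₘ (h.i ≫ k.r)) =
      ((h.i ≫ k.r) ⊗ₘ (h.i ≫ k.r)) ≫ W.chi (W.act k) (W.act k) := by
  have e1 := W.comul_natural (h.i ≫ k.r) (h.i ≫ k.r)
  rw [chi, chi, ← Category.assoc (_ ⊗ₘ _), W.unit_natural, Category.assoc, Category.assoc,
    Category.assoc, reassoc_of% e1, tensorHom_comp_tensorHom, tensorHom_comp_tensorHom,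
    hh.map_comp_act hk e]

end IsBase

/-! ### The structure of a base object and its independence of the section -/

variable (W h)

/-- The monoid and comonoid structure of a base object, with multiplication `(R ⊗ ε).χ` and
comultiplication `χ.(R ⊗ η)`. -/
def data : MonComonData ‹MonoidalCategory C› R where
  mul := W.chi (W.act h) (W.act h) ≫ R ◁ W.eps h ≫ (ρ_ R).hom
  one := W.one h
  comul := (ρ_ R).inv ≫ R ◁ W.one h ≫ W.chi (W.act h) (W.act h)
  counit := W.eps h

/-- The monoid and comonoid structure of a base object, with multiplication `(ε ⊗ R).χ` and
comultiplication `χ.(η ⊗ R)`. -/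
def data' : MonComonData ‹MonoidalCategory C› R where
  mul := W.chi (W.act h) (W.act h) ≫ W.eps h ▷ R ≫ (λ_ R).hom
  one := W.one h
  comul := (λ_ R).inv ≫ W.one h ▷ R ≫ W.chi (W.act h) (W.act h)
  counit := W.eps h

variable {W h}

theorem IsBase.data'_eq (hh : W.IsBase h) : W.data' h = W.data h := by
  rw [data, data', hh.compatibleEndo.mul_eq, hh.compatibleEndo.comul_eq]

theorem IsBase.isMonoidAndComonoid (hh : W.IsBase h) : (W.data h).IsMonoidAndComonoid :=
  ⟨⟨{ one := W.one h
      mul := W.chi (W.act h) (W.act h) ≫ R ◁ W.eps h ≫ (ρ_ R).hom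
      one_mul := hh.compatibleEndo.one_mul
      mul_one := hh.compatibleEndo.mul_one
      mul_assoc := hh.compatibleEndo.mul_assoc }, rfl, rfl⟩,
    { counit := W.eps h
      comul := (ρ_ R).inv ≫ R ◁ W.one h ≫ W.chi (W.act h) (W.act h)
      counit_comul := hh.compatibleEndo.counit_comul
      comul_counit := hh.compatibleEndo.comul_counit
      comul_assoc := hh.compatibleEndo.comul_assoc }, rfl, rfl⟩

theorem IsBase.isomorphic (hh : W.IsBase h) (hk : W.IsBase k) (e : h.r ≫ h.i ≫ k.r = k.r)
    (e' : k.r ≫ k.i ≫ h.r = h.r) : (W.data h).Isomorphic (W.data k) := by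
  have e1 : W.one h ≫ h.i ≫ k.r = W.one k := by rw [one, one, Category.assoc, e]
  have e2 : (h.i ≫ k.r) ≫ W.eps k = W.eps h := by
    rw [Category.assoc, hk.r_eps, eps]
  refine ⟨⟨h.i ≫ k.r, k.i ≫ h.r, ?_, ?_⟩, ?_, e1, ?_, e2⟩
  · rw [Category.assoc, e', h.retract]
  · rw [Category.assoc, e, k.retract]
  · change (W.chi (W.act h) (W.act h) ≫ R ◁ W.eps h ≫ (ρ_ R).hom) ≫ h.i ≫ k.r =
      ((h.i ≫ k.r) ⊗ₘ (h.i ≫ k.r)) ≫ W.chi (W.act k) (W.act k) ≫ S ◁ W.eps k ≫ (ρ_ S).hom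
    rw [← reassoc_of% hh.chi_comp hk e, Category.assoc, Category.assoc, ← rightUnitor_naturality,
      ← id_tensorHom, ← id_tensorHom, tensorHom_comp_tensorHom_assoc, e2, ← tensorHom_id,
      tensorHom_comp_tensorHom_assoc, Category.id_comp, Category.comp_id, Category.comp_id]
  · change (h.i ≫ k.r) ≫ (ρ_ S).inv ≫ S ◁ W.one k ≫ W.chi (W.act k) (W.act k) =
      ((ρ_ R).inv ≫ R ◁ W.one h ≫ W.chi (W.act h) (W.act h)) ≫ ((h.i ≫ k.r) ⊗ₘ (h.i ≫ k.r))
    have e3 := hh.chi_comp hk e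
    generalize h.i ≫ k.r = f at e1 e3 ⊢
    rw [Category.assoc, Category.assoc, e3, ← id_tensorHom R, tensorHom_comp_tensorHom_assoc, e1,
      Category.id_comp, MonoidalCategory.tensorHom_def, Category.assoc,
      ← rightUnitor_inv_naturality_assoc]

end WeakBimonad

/-! ### The monad `- ⊗ A` of a monoid -/

section MonoidActions

variable {C : Type u} [Category.{v} C] [MonoidalCategory C] (A : C) [MonObj A]

theorem tensor_unit_natural {X Y : C} (f : X ⟶ Y) :
    f ≫ (ρ_ Y).inv ≫ Y ◁ MonObj.one = ((ρ_ X).inv ≫ X ◁ MonObj.one) ≫ f ▷ A := by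
  rw [rightUnitor_inv_naturality_assoc, ← whisker_exchange, Category.assoc]

theorem tensor_mult_natural {X Y : C} (f : X ⟶ Y) :
    f ▷ A ▷ A ≫ (α_ Y A A).hom ≫ Y ◁ MonObj.mul =
      ((α_ X A A).hom ≫ X ◁ MonObj.mul) ≫ f ▷ A := by
  rw [associator_naturality_left_assoc, Category.assoc, whisker_exchange]

theorem tensor_unit_mult (X : C) :
    ((ρ_ (X ⊗ A)).inv ≫ (X ⊗ A) ◁ MonObj.one) ≫ (α_ X A A).hom ≫ X ◁ MonObj.mul =
      𝟙 (X ⊗ A) := by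
  rw [Category.assoc, associator_naturality_right_assoc, ← MonoidalCategory.whiskerLeft_comp,
    MonObj.mul_one]
  simp

theorem tensor_map_unit_mult (X : C) :
    ((ρ_ X).inv ≫ X ◁ MonObj.one) ▷ A ≫ (α_ X A A).hom ≫ X ◁ MonObj.mul = 𝟙 (X ⊗ A) := by
  rw [MonoidalCategory.comp_whiskerRight, Category.assoc, associator_naturality_middle_assoc,
    ← MonoidalCategory.whiskerLeft_comp, MonObj.one_mul]
  simp

theorem tensor_mult_assoc (X : C) :
    ((α_ X A A).hom ≫ X ◁ MonObj.mul) ▷ A ≫ (α_ X A A).hom ≫ X ◁ MonObj.mul =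
      ((α_ (X ⊗ A) A A).hom ≫ (X ⊗ A) ◁ MonObj.mul) ≫ (α_ X A A).hom ≫ X ◁ MonObj.mul := by
  rw [MonoidalCategory.comp_whiskerRight, Category.assoc, associator_naturality_middle_assoc,
    ← MonoidalCategory.whiskerLeft_comp, MonObj.mul_assoc, Category.assoc,
    associator_naturality_right_assoc]
  simp

theorem whiskerLeft_rightUnitor_inv_comp {Q N X : C} (a : 𝟙_ C ⟶ X) :
    Q ◁ (ρ_ N).inv ≫ Q ◁ (N ◁ a) ≫ (α_ Q N X).inv = (ρ_ (Q ⊗ N)).inv ≫ (Q ⊗ N) ◁ a := by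
  simp

end MonoidActions

/-- Cancelling the monoidal unit in an equation between composites of whiskered morphisms. -/
theorem unit_whisker_cancel {C : Type u} [Category.{v} C] [MonoidalCategory C]
    {X Y Z X₁ Y₁ Y₂ Y₃ Z₁ : C} {E₁ : Y ⊗ Z ⟶ Y₁ ⊗ Z₁} {E₂ : X ⊗ Y₁ ⟶ X₁ ⊗ Y₂} {m : Y₂ ⟶ Y₃}
    {W : C} {E₃ : X ⊗ (Y ⊗ Z) ⟶ X₁ ⊗ W} {c : W ⟶ Y₃ ⊗ Z₁}
    (h : ((α_ (𝟙_ C ⊗ X) Y Z).hom ≫ (𝟙_ C ⊗ X) ◁ E₁ ≫ (α_ (𝟙_ C ⊗ X) Y₁ Z₁).inv) ≫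
        ((α_ (𝟙_ C) X Y₁).hom ≫ 𝟙_ C ◁ E₂ ≫ (α_ (𝟙_ C) X₁ Y₂).inv) ▷ Z₁ ≫
          ((𝟙_ C ⊗ X₁) ◁ m) ▷ Z₁ =
      (α_ (𝟙_ C ⊗ X) Y Z).hom ≫ ((α_ (𝟙_ C) X (Y ⊗ Z)).hom ≫ 𝟙_ C ◁ E₃ ≫
        (α_ (𝟙_ C) X₁ W).inv) ≫ (𝟙_ C ⊗ X₁) ◁ c ≫ (α_ (𝟙_ C ⊗ X₁) Y₃ Z₁).inv) :
    X ◁ E₁ ≫ (α_ X Y₁ Z₁).inv ≫ (E₂ ≫ X₁ ◁ m) ▷ Z₁ = E₃ ≫ X₁ ◁ c ≫ (α_ X₁ Y₃ Z₁).inv := by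
  have h1 := (λ_ (X ⊗ (Y ⊗ Z))).inv ≫= (α_ (𝟙_ C) X (Y ⊗ Z)).inv ≫=
    (α_ (𝟙_ C ⊗ X) Y Z).inv ≫= (h =≫ ((λ_ X₁).hom ▷ Y₃) ▷ Z₁)
  refine Eq.trans ?_ (h1.trans ?_) <;> monoidal

end Abstract

/-! ### The weak bimonad of a right weak bimonoid -/

section Duoidal

variable {C : Type u} [Category.{v} C] {circ bullet : MonoidalCategory C}

local notation "𝐈" => circ.tensorUnit
local notation "𝐉" => bullet.tensorUnit
local infixr:70 " ⊚ " => circ.tensorObj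
local infixr:70 " ⊛ " => bullet.tensorObj
local infixr:70 " ⊚ₘ " => circ.tensorHom
local infixr:70 " ⊛ₘ " => bullet.tensorHom
local infixr:81 " ◁⊚ " => circ.whiskerLeft
local infixl:81 " ▷⊚ " => circ.whiskerRight
local infixr:81 " ◁⊛ " => bullet.whiskerLeft
local infixl:81 " ▷⊛ " => bullet.whiskerRight
local notation "α⊚" => circ.associator
local notation "α⊛" => bullet.associator
local notation "λ⊚" => circ.leftUnitor
local notation "λ⊛" => bullet.leftUnitor
local notation "ρ⊚" => circ.rightUnitor
local notation "ρ⊛" => bullet.rightUnitor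

namespace DuoidalStructure

variable (D : DuoidalStructure circ bullet) {A : C} (B : MonoidComonoid circ bullet A)

theorem ζ_natural_left {X X' Y Y' : C} (f : X ⟶ X') (g : Y ⟶ Y') (Z W : C) :
    (f ⊛ₘ g) ▷⊚ (Z ⊛ W) ≫ D.ζ X' Y' Z W = D.ζ X Y Z W ≫ (f ▷⊚ Z ⊛ₘ g ▷⊚ W) := by
  have h := D.ζ_natural f g (𝟙 Z) (𝟙 W)
  rw [@MonoidalCategory.id_tensorHom_id C _ bullet, @MonoidalCategory.tensorHom_id C _ circ,
    @MonoidalCategory.tensorHom_id C _ circ, @MonoidalCategory.tensorHom_id C _ circ] at h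
  exact h

theorem ζ_natural_right (X Y : C) {Z Z' W W' : C} (h : Z ⟶ Z') (k : W ⟶ W') :
    (X ⊛ Y) ◁⊚ (h ⊛ₘ k) ≫ D.ζ X Y Z' W' = D.ζ X Y Z W ≫ (X ◁⊚ h ⊛ₘ Y ◁⊚ k) := by
  have h := D.ζ_natural (𝟙 X) (𝟙 Y) h k
  rw [@MonoidalCategory.id_tensorHom_id C _ bullet, @MonoidalCategory.id_tensorHom C _ circ,
    @MonoidalCategory.id_tensorHom C _ circ, @MonoidalCategory.id_tensorHom C _ circ] at h
  exact h

/-- The unit of the monad `- ⊚ A`. -/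
def tUnit (X : C) : X ⟶ X ⊚ A := (ρ⊚ X).inv ≫ X ◁⊚ B.η

/-- The multiplication of the monad `- ⊚ A`. -/
def tMult (X : C) : (X ⊚ A) ⊚ A ⟶ X ⊚ A := (α⊚ X A A).hom ≫ X ◁⊚ B.μ

/-- The opmonoidal structure of the functor `- ⊚ A`. -/
def tComul (X Y : C) : (X ⊛ Y) ⊚ A ⟶ (X ⊚ A) ⊛ (Y ⊚ A) := (X ⊛ Y) ◁⊚ B.Δ ≫ D.ζ X Y A A

/-- The counit of the opmonoidal functor `- ⊚ A`. -/
def tCounit : 𝐉 ⊚ A ⟶ 𝐉 := 𝐉 ◁⊚ B.ε ≫ D.ϖ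

theorem tComul_natural {X Y X' Y' : C} (f : X ⟶ X') (g : Y ⟶ Y') :
    (f ⊛ₘ g) ▷⊚ A ≫ D.tComul B X' Y' = D.tComul B X Y ≫ (f ▷⊚ A ⊛ₘ g ▷⊚ A) := by
  rw [tComul, tComul, ← @MonoidalCategory.whisker_exchange_assoc C _ circ,
    D.ζ_natural_left f g A A,
    Category.assoc]

theorem tComul_assoc (X Y Z : C) :
    D.tComul B (X ⊛ Y) Z ≫ D.tComul B X Y ▷⊛ (Z ⊚ A) ≫ (α⊛ _ _ _).hom =
      (α⊛ X Y Z).hom ▷⊚ A ≫ D.tComul B X (Y ⊛ Z) ≫ (X ⊚ A) ◁⊛ D.tComul B Y Z := by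
  have h1 := D.ζ_natural_right (X ⊛ Y) Z B.Δ (𝟙 A)
  rw [@MonoidalCategory.tensorHom_id C _ bullet, @MonoidalCategory.whiskerLeft_id C _ circ,
    @MonoidalCategory.tensorHom_id C _ bullet] at h1
  have h2 := D.ζ_natural_right X (Y ⊛ Z) (𝟙 A) B.Δ
  rw [@MonoidalCategory.id_tensorHom C _ bullet, @MonoidalCategory.whiskerLeft_id C _ circ,
    @MonoidalCategory.id_tensorHom C _ bullet] at h2
  have h3 : B.Δ ≫ A ◁⊛ B.Δ = B.Δ ≫ B.Δ ▷⊛ A ≫ (α⊛ A A A).hom := B.comon.comul_assoc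
  have h4 := D.ζ_assoc_bullet X Y Z A A A
  simp only [tComul, @MonoidalCategory.comp_whiskerRight C _ bullet,
    @MonoidalCategory.whiskerLeft_comp C _ bullet, Category.assoc]
  rw [← reassoc_of% h1, h4, ← reassoc_of% h2,
    ← @MonoidalCategory.whisker_exchange_assoc C _ circ,
    ← @MonoidalCategory.whisker_exchange_assoc C _ circ, @MonoidalCategory.tensorHom_def' C _ circ]
  simp only [Category.assoc, ← @MonoidalCategory.whiskerLeft_comp_assoc C _ circ]
  rw [h3]

theorem tCounit_comul (X : C) :
    (λ⊛ X).inv ▷⊚ A ≫ D.tComul B 𝐉 X ≫ D.tCounit B ▷⊛ (X ⊚ A) = (λ⊛ (X ⊚ A)).inv := by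
  have h1 := D.ζ_natural_right 𝐉 X B.ε (𝟙 A)
  rw [@MonoidalCategory.tensorHom_id C _ bullet, @MonoidalCategory.whiskerLeft_id C _ circ,
    @MonoidalCategory.tensorHom_id C _ bullet] at h1
  have h3 : B.Δ ≫ B.ε ▷⊛ A = (λ⊛ A).inv := B.comon.counit_comul
  have h4 := D.ζ_unit_left_bullet X A
  rw [← cancel_mono (λ⊛ (X ⊚ A)).hom, Iso.inv_hom_id, ← h4, tComul, tCounit,
    @MonoidalCategory.tensorHom_def C _ circ, ← h3]
  simp only [@MonoidalCategory.comp_whiskerRight C _ bullet,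
    @MonoidalCategory.whiskerLeft_comp C _ circ, Category.assoc, ← reassoc_of% h1]

theorem tComul_counit (X : C) :
    (ρ⊛ X).inv ▷⊚ A ≫ D.tComul B X 𝐉 ≫ (X ⊚ A) ◁⊛ D.tCounit B = (ρ⊛ (X ⊚ A)).inv :=
  -- Left-right mirror images hold by definition: reversing `⊛` swaps the two factors of `ζ` and of
  -- the coproduct.
  D.bulletRev.tCounit_comul B.bulletRev X

/-- `LLC` in terms of the monad, up to exchanging the comultiplication with a unitor and using
associativity of the multiplication. -/
theorem tCounit_mult_right (h : D.LLC B) :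
    ((λ⊛ (𝐉 ⊚ A)).inv ▷⊚ A ≫ D.tComul B 𝐉 (𝐉 ⊚ A) ≫
        (𝐉 ⊚ A) ◁⊛ (tMult B 𝐉 ≫ D.tCounit B) ≫ (ρ⊛ _).hom) ▷⊚ A ≫ tMult B 𝐉 ≫ D.tCounit B =
      tMult B 𝐉 ▷⊚ A ≫ tMult B 𝐉 ≫ D.tCounit B := by
  have e : tMult B 𝐉 ≫ D.tCounit B = D.counitMul B := by
    simp only [tMult, tCounit, counitMul, @MonoidalCategory.whiskerLeft_comp C _ circ,
      Category.assoc]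
  have e1 : tMult B 𝐉 ▷⊚ A ≫ tMult B 𝐉 = tMult B (𝐉 ⊚ A) ≫ tMult B 𝐉 :=
    @tensor_mult_assoc C _ circ A B.mon 𝐉
  have h' : _ = _ := h
  rw [reassoc_of% e1, e, tComul, ← Category.assoc (_ ▷⊚ A), ← Category.assoc (_ ▷⊚ A),
    ← @MonoidalCategory.whisker_exchange C _ circ]
  simp only [@MonoidalCategory.comp_whiskerRight C _ circ, Category.assoc]
  rw [h']
  simp only [← e, tMult, tCounit, Category.assoc]

theorem tCounit_mult_left (h : D.LRC B) :
    ((ρ⊛ (𝐉 ⊚ A)).inv ▷⊚ A ≫ D.tComul B (𝐉 ⊚ A) 𝐉 ≫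
        (tMult B 𝐉 ≫ D.tCounit B) ▷⊛ (𝐉 ⊚ A) ≫ (λ⊛ _).hom) ▷⊚ A ≫ tMult B 𝐉 ≫ D.tCounit B =
      tMult B 𝐉 ▷⊚ A ≫ tMult B 𝐉 ≫ D.tCounit B :=
  D.bulletRev.tCounit_mult_right B.bulletRev h

/-- The composite of the unit and the opmonoidal structure. -/
def splitUnit (X Y : C) : X ⊛ Y ⟶ (X ⊚ A) ⊛ (Y ⊚ A) := tUnit B (X ⊛ Y) ≫ D.tComul B X Y

/-- The morphism `I ⟶ (I ⊛ A) ⊛ A` induced by the coproduct of the unit. -/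
def unitElem : 𝐈 ⟶ (𝐈 ⊛ A) ⊛ A := D.δ ≫ 𝐈 ◁⊛ (B.η ≫ B.Δ) ≫ (α⊛ 𝐈 A A).inv

/-- Unlike `splitUnit`, this keeps the factor `𝐈` occurring in `RRU`; `unitShift` absorbs it later.
-/
def unitElemAct (P Y : C) : P ⊛ Y ⟶ (P ⊚ (𝐈 ⊛ A)) ⊛ (Y ⊚ A) :=
  (ρ⊚ (P ⊛ Y)).inv ≫ (P ⊛ Y) ◁⊚ D.unitElem B ≫ D.ζ P Y (𝐈 ⊛ A) A

variable (A) in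
def unitShift (P Y : C) : (P ⊛ Y) ⊚ (𝐈 ⊛ A) ⟶ P ⊛ (Y ⊚ A) :=
  D.ζ P Y 𝐈 A ≫ (ρ⊚ P).hom ▷⊛ (Y ⊚ A)

/-- The operation that `RRU` applies to the left leg of `unitElem`: a second copy of the unit
element is multiplied in. -/
def unitElemMul : 𝐈 ⊛ A ⟶ (𝐈 ⊛ A) ⊛ A :=
  (ρ⊚ (𝐈 ⊛ A)).inv ≫ (𝐈 ⊛ A) ◁⊚ D.unitElem B ≫ D.ζ 𝐈 A (𝐈 ⊛ A) A ≫
    (λ⊚ (𝐈 ⊛ A)).hom ▷⊛ (A ⊚ A) ≫ (𝐈 ⊛ A) ◁⊛ B.μ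

theorem RRU.eq (h : D.RRU B) :
    D.unitElem B ≫ D.unitElemMul B ▷⊛ A =
      D.unitElem B ≫ (𝐈 ⊛ A) ◁⊛ B.Δ ≫ (α⊛ (𝐈 ⊛ A) A A).inv := by
  have h' : _ = _ := h
  simp only [unitElem, unitElemMul, @MonoidalCategory.comp_whiskerRight C _ bullet,
    @MonoidalCategory.whiskerLeft_comp C _ circ,
    Category.assoc, @MonoidalCategory.whiskerLeft_comp C _ bullet] at h' ⊢
  exact h'

theorem δ_ζ (P Q : C) :
    (ρ⊚ (P ⊛ Q)).inv ≫ (P ⊛ Q) ◁⊚ D.δ ≫ D.ζ P Q 𝐈 𝐈 = (ρ⊚ P).inv ⊛ₘ (ρ⊚ Q).inv := by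
  have h := D.ζ_unit_right_circ P Q
  have h' : ((ρ⊚ P).hom ⊛ₘ (ρ⊚ Q).hom) ≫ ((ρ⊚ P).inv ⊛ₘ (ρ⊚ Q).inv) = 𝟙 _ := by
    rw [@MonoidalCategory.tensorHom_comp_tensorHom C _ bullet, Iso.hom_inv_id, Iso.hom_inv_id,
      @MonoidalCategory.id_tensorHom_id C _ bullet]
  have := h =≫ ((ρ⊚ P).inv ⊛ₘ (ρ⊚ Q).inv)
  simpa only [Category.assoc, h', Category.comp_id, Category.id_comp] using this

/-- Associativity of `ζ` for `⊛` separates the factor `𝐈`, and its unitality for `⊚` makes `𝐈` act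
trivially on `P`. What remains is `splitUnit` on the last two factors. -/
theorem unitElemAct_unitShift (P Y Z : C) :
    D.unitElemAct B (P ⊛ Y) Z ≫ D.unitShift A P Y ▷⊛ (Z ⊚ A) ≫ (α⊛ _ _ _).hom =
      (α⊛ P Y Z).hom ≫ P ◁⊛ D.splitUnit B Y Z := by
  have h2 := D.ζ_natural_right P (Y ⊛ Z) (𝟙 𝐈) (B.η ≫ B.Δ)
  rw [@MonoidalCategory.id_tensorHom C _ bullet, @MonoidalCategory.whiskerLeft_id C _ circ,
    @MonoidalCategory.id_tensorHom C _ bullet] at h2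
  have h4 := D.ζ_assoc_bullet P Y Z 𝐈 A A
  have ha : ((P ⊛ Y) ⊛ Z) ◁⊚ D.unitElem B ≫ ((α⊛ P Y Z).hom ⊚ₘ (α⊛ 𝐈 A A).hom) =
      (α⊛ P Y Z).hom ▷⊚ 𝐈 ≫ (P ⊛ (Y ⊛ Z)) ◁⊚ D.δ ≫ (P ⊛ (Y ⊛ Z)) ◁⊚ (𝐈 ◁⊛ (B.η ≫ B.Δ)) := by
    rw [@MonoidalCategory.tensorHom_def' C _ circ,
      ← @MonoidalCategory.whiskerLeft_comp_assoc C _ circ,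
      ← @MonoidalCategory.whiskerLeft_comp C _ circ, unitElem, Category.assoc, Category.assoc,
      Iso.inv_hom_id, Category.comp_id, @MonoidalCategory.whisker_exchange C _ circ]
  simp only [unitElemAct, unitShift, @MonoidalCategory.comp_whiskerRight C _ bullet,
    Category.assoc]
  rw [@MonoidalCategory.associator_naturality_left C _ bullet, reassoc_of% h4, reassoc_of% ha,
    reassoc_of% h2, ← @MonoidalCategory.rightUnitor_inv_naturality_assoc C _ circ,
    reassoc_of% (D.δ_ζ P (Y ⊛ Z)), @MonoidalCategory.tensorHom_def' C _ bullet]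
  simp only [Category.assoc, @MonoidalCategory.whisker_exchange C _ bullet,
    @MonoidalCategory.whisker_exchange_assoc C _ bullet]
  rw [← @MonoidalCategory.comp_whiskerRight_assoc C _ bullet, Iso.inv_hom_id,
    @MonoidalCategory.id_whiskerRight C _ bullet, Category.id_comp]
  simp only [splitUnit, tUnit, tComul, Category.assoc,
    @MonoidalCategory.whiskerLeft_comp C _ bullet, @MonoidalCategory.whiskerLeft_comp C _ circ]

theorem unitElemAct_unitShift' (P Y Z : C) :
    (α⊛ P Y Z).hom ≫ P ◁⊛ D.splitUnit B Y Z ≫ (α⊛ _ _ _).inv =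
      D.unitElemAct B (P ⊛ Y) Z ≫ D.unitShift A P Y ▷⊛ (Z ⊚ A) := by
  rw [← Category.assoc, ← unitElemAct_unitShift, Category.assoc, Category.assoc, Iso.hom_inv_id,
    Category.comp_id]

/-- Acting by a product is acting twice: this is associativity of `ζ` for `⊚`. -/
theorem unitElemMul_ζ (P Y : C) :
    (P ⊛ Y) ◁⊚ D.unitElemMul B ≫ D.ζ P Y (𝐈 ⊛ A) A =
      D.unitShift A P Y ≫ D.unitElemAct B P (Y ⊚ A) ≫ (P ⊚ (𝐈 ⊛ A)) ◁⊛ tMult B Y := by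
  have h1 := D.ζ_natural_right P Y (λ⊚ (𝐈 ⊛ A)).hom B.μ
  rw [@MonoidalCategory.tensorHom_def C _ bullet _ _ _ _ (λ⊚ (𝐈 ⊛ A)).hom B.μ,
    @MonoidalCategory.whiskerLeft_comp C _ circ, Category.assoc] at h1
  have h2 := (Iso.inv_comp_eq _).2 (D.ζ_assoc_circ P Y 𝐈 A (𝐈 ⊛ A) A)
  have h3 := D.ζ_natural_left (ρ⊚ P).hom (𝟙 (Y ⊚ A)) (𝐈 ⊛ A) A
  rw [@MonoidalCategory.tensorHom_id C _ bullet, @MonoidalCategory.id_whiskerRight C _ circ,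
    @MonoidalCategory.tensorHom_id C _ bullet] at h3
  have h4 := @whiskerLeft_rightUnitor_inv_comp C _ circ (P ⊛ Y) (𝐈 ⊛ A) _ (D.unitElem B)
  have h5 : (α⊚ P 𝐈 (𝐈 ⊛ A)).hom ≫ P ◁⊚ (λ⊚ (𝐈 ⊛ A)).hom = (ρ⊚ P).hom ▷⊚ (𝐈 ⊛ A) :=
    @MonoidalCategory.triangle C _ circ P (𝐈 ⊛ A)
  simp only [unitElemMul, unitShift, unitElemAct, tMult, Category.assoc,
    @MonoidalCategory.whiskerLeft_comp C _ circ]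
  rw [h1, ← reassoc_of% h2, reassoc_of% h4,
    @MonoidalCategory.whisker_exchange_assoc C _ circ,
    ← @MonoidalCategory.rightUnitor_inv_naturality_assoc C _ circ,
    @MonoidalCategory.tensorHom_comp_tensorHom C _ bullet, h5,
    @MonoidalCategory.tensorHom_def C _ bullet]
  have h6 : (ρ⊚ P).hom ▷⊛ (Y ⊚ A) ≫ (ρ⊚ (P ⊛ (Y ⊚ A))).inv ≫
      (P ⊛ (Y ⊚ A)) ◁⊚ D.unitElem B ≫ D.ζ P (Y ⊚ A) (𝐈 ⊛ A) A =
        (ρ⊚ ((P ⊚ 𝐈) ⊛ (Y ⊚ A))).inv ≫ ((P ⊚ 𝐈) ⊛ (Y ⊚ A)) ◁⊚ D.unitElem B ≫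
          D.ζ (P ⊚ 𝐈) (Y ⊚ A) (𝐈 ⊛ A) A ≫ (ρ⊚ P).hom ▷⊚ (𝐈 ⊛ A) ▷⊛ ((Y ⊚ A) ⊚ A) := by
    rw [@MonoidalCategory.rightUnitor_inv_naturality_assoc C _ circ,
      ← @MonoidalCategory.whisker_exchange_assoc C _ circ, h3]
  rw [reassoc_of% h6]

theorem splitUnit_right (h : D.RRU B) (X Y Z : C) :
    X ◁⊛ D.splitUnit B Y Z ≫ (α⊛ _ _ _).inv ≫
        (D.splitUnit B X (Y ⊚ A) ≫ (X ⊚ A) ◁⊛ tMult B Y) ▷⊛ (Z ⊚ A) =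
      D.splitUnit B X (Y ⊛ Z) ≫ (X ⊚ A) ◁⊛ D.tComul B Y Z ≫ (α⊛ _ _ _).inv := by
  have h' := RRU.eq D B h
  -- The leg `𝐈 ⊛ A` of the unit element needs an object with two `⊛`-factors to act on, so `X` is
  -- padded to `𝐉 ⊛ X`.
  apply @unit_whisker_cancel C _ bullet
  simp only [unitElemAct_unitShift']
  have n1 := D.ζ_natural_right ((𝐉 ⊛ X) ⊛ Y) Z (D.unitElemMul B) (𝟙 A)
  rw [@MonoidalCategory.tensorHom_id C _ bullet, @MonoidalCategory.whiskerLeft_id C _ circ,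
    @MonoidalCategory.tensorHom_id C _ bullet] at n1
  have n2 := D.ζ_natural_right (𝐉 ⊛ X) (Y ⊛ Z) (𝟙 (𝐈 ⊛ A)) B.Δ
  rw [@MonoidalCategory.id_tensorHom C _ bullet, @MonoidalCategory.whiskerLeft_id C _ circ,
    @MonoidalCategory.id_tensorHom C _ bullet] at n2
  have n3 : D.ζ ((𝐉 ⊛ X) ⊛ Y) Z ((𝐈 ⊛ A) ⊛ A) A ≫ D.ζ (𝐉 ⊛ X) Y (𝐈 ⊛ A) A ▷⊛ (Z ⊚ A) =
      ((α⊛ (𝐉 ⊛ X) Y Z).hom ⊚ₘ (α⊛ (𝐈 ⊛ A) A A).hom) ≫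
        D.ζ (𝐉 ⊛ X) (Y ⊛ Z) (𝐈 ⊛ A) (A ⊛ A) ≫ _ ◁⊛ D.ζ Y Z A A ≫ (α⊛ _ _ _).inv := by
    have := D.ζ_assoc_bullet (𝐉 ⊛ X) Y Z (𝐈 ⊛ A) A A
    rw [← Category.assoc, ← Iso.eq_comp_inv] at this
    rw [this]
    simp only [Category.assoc]
  have hL : (ρ⊚ (((𝐉 ⊛ X) ⊛ Y) ⊛ Z)).inv ≫
      (((𝐉 ⊛ X) ⊛ Y) ⊛ Z) ◁⊚ (D.unitElem B ≫ D.unitElemMul B ▷⊛ A) ≫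
        D.ζ ((𝐉 ⊛ X) ⊛ Y) Z ((𝐈 ⊛ A) ⊛ A) A ≫ D.ζ (𝐉 ⊛ X) Y (𝐈 ⊛ A) A ▷⊛ (Z ⊚ A) =
      D.unitElemAct B ((𝐉 ⊛ X) ⊛ Y) Z ≫ (D.unitShift A (𝐉 ⊛ X) Y ≫
        D.unitElemAct B (𝐉 ⊛ X) (Y ⊚ A) ≫ ((𝐉 ⊛ X) ⊚ (𝐈 ⊛ A)) ◁⊛ tMult B Y) ▷⊛ (Z ⊚ A) := by
    rw [← unitElemMul_ζ]
    conv_rhs => rw [unitElemAct]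
    simp only [@MonoidalCategory.whiskerLeft_comp C _ circ,
      @MonoidalCategory.comp_whiskerRight C _ bullet, Category.assoc, reassoc_of% n1]
  have hR : (ρ⊚ (((𝐉 ⊛ X) ⊛ Y) ⊛ Z)).inv ≫
      (((𝐉 ⊛ X) ⊛ Y) ⊛ Z) ◁⊚ (D.unitElem B ≫ (𝐈 ⊛ A) ◁⊛ B.Δ ≫ (α⊛ (𝐈 ⊛ A) A A).inv) ≫
        D.ζ ((𝐉 ⊛ X) ⊛ Y) Z ((𝐈 ⊛ A) ⊛ A) A ≫ D.ζ (𝐉 ⊛ X) Y (𝐈 ⊛ A) A ▷⊛ (Z ⊚ A) =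
      (α⊛ (𝐉 ⊛ X) Y Z).hom ≫ D.unitElemAct B (𝐉 ⊛ X) (Y ⊛ Z) ≫
        ((𝐉 ⊛ X) ⊚ (𝐈 ⊛ A)) ◁⊛ D.tComul B Y Z ≫ (α⊛ _ _ _).inv := by
    rw [n3, @MonoidalCategory.tensorHom_def' C _ circ, Category.assoc,
      ← @MonoidalCategory.whiskerLeft_comp_assoc C _ circ, Category.assoc, Category.assoc,
      Iso.inv_hom_id, Category.comp_id, @MonoidalCategory.whisker_exchange_assoc C _ circ,
      ← @MonoidalCategory.rightUnitor_inv_naturality_assoc C _ circ, unitElemAct, tComul]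
    simp only [@MonoidalCategory.whiskerLeft_comp C _ circ,
      @MonoidalCategory.whiskerLeft_comp C _ bullet, Category.assoc, reassoc_of% n2]
  -- `hL` and `hR` are the two sides of `RRU`, each acting on the same threefold product.
  have hLR := hL.symm.trans ((by rw [h'] : _ = _).trans hR)
  -- The remaining `𝐈` is absorbed by the padding `𝐉`, which leaves `X ⊚ A`.
  have hLR' := hLR =≫ (D.unitShift A 𝐉 X ▷⊛ (Y ⊚ A)) ▷⊛ (Z ⊚ A)
  have x1 : (((𝐉 ⊛ X) ⊚ (𝐈 ⊛ A)) ◁⊛ tMult B Y) ▷⊛ (Z ⊚ A) ≫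
      (D.unitShift A 𝐉 X ▷⊛ (Y ⊚ A)) ▷⊛ (Z ⊚ A) =
      (D.unitShift A 𝐉 X ▷⊛ ((Y ⊚ A) ⊚ A)) ▷⊛ (Z ⊚ A) ≫
        ((𝐉 ⊛ (X ⊚ A)) ◁⊛ tMult B Y) ▷⊛ (Z ⊚ A) := by
    simp only [← @MonoidalCategory.comp_whiskerRight C _ bullet,
      @MonoidalCategory.whisker_exchange C _ bullet]
  simp only [Category.assoc, @MonoidalCategory.comp_whiskerRight C _ bullet, x1] at hLR' ⊢
  rw [hLR', ← @MonoidalCategory.associator_inv_naturality_left C _ bullet,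
    @MonoidalCategory.whisker_exchange_assoc C _ bullet]

theorem splitUnit_left (h : D.LRU B) (X Y Z : C) :
    D.splitUnit B X Y ▷⊛ Z ≫ (α⊛ _ _ _).hom ≫
        (X ⊚ A) ◁⊛ (D.splitUnit B (Y ⊚ A) Z ≫ tMult B Y ▷⊛ (Z ⊚ A)) =
      D.splitUnit B (X ⊛ Y) Z ≫ D.tComul B X Y ▷⊛ (Z ⊚ A) ≫ (α⊛ _ _ _).hom :=
  D.bulletRev.splitUnit_right B.bulletRev h Z Y X

/-- The weak bimonad `- ⊚ A` induced by a right weak bimonoid `A`. -/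
def weakBimonad (h : D.IsRightWeakBimonoid B) : @WeakBimonad C _ bullet where
  T := { obj X := X ⊚ A
         map f := f ▷⊚ A
         map_id X := @MonoidalCategory.id_whiskerRight C _ circ X A
         map_comp f g := @MonoidalCategory.comp_whiskerRight C _ circ _ _ _ f g A }
  unit := tUnit B
  mult := tMult B
  comul := D.tComul B
  counit := D.tCounit B
  unit_natural f := @tensor_unit_natural C _ circ A B.mon _ _ f
  mult_natural f := @tensor_mult_natural C _ circ A B.mon _ _ f
  unit_mult := @tensor_unit_mult C _ circ A B.mon
  map_unit_mult := @tensor_map_unit_mult C _ circ A B.mon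
  mult_assoc := @tensor_mult_assoc C _ circ A B.mon
  comul_natural := D.tComul_natural B
  comul_assoc := D.tComul_assoc B
  counit_comul := D.tCounit_comul B
  comul_counit := D.tComul_counit B
  unit_comul_left X Y Z := by
    have e := D.splitUnit_left B h.lru X Y Z
    have e' : (α⊛ X Y Z).hom ≫ tUnit B (X ⊛ (Y ⊛ Z)) =
        tUnit B ((X ⊛ Y) ⊛ Z) ≫ (α⊛ X Y Z).hom ▷⊚ A :=
      @tensor_unit_natural C _ circ A B.mon _ _ (α⊛ X Y Z).hom
    simp only [splitUnit, Category.assoc] at e ⊢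
    rw [e, D.tComul_assoc B X Y Z, reassoc_of% e']
  unit_comul_right X Y Z := by
    have e := D.splitUnit_right B h.rru X Y Z
    simp only [splitUnit, Category.assoc] at e ⊢
    exact e
  counit_mult_right := D.tCounit_mult_right B h.llc
  counit_mult_left := D.tCounit_mult_left B h.lrc

/-! ### Self-duality of the axioms under `∗` -/

theorem mulComul_op (h : D.MulComul B) : D.op.MulComul B.op := by
  have h' : _ = _ := h
  refine Quiver.Hom.unop_inj ?_
  change B.μ ≫ B.Δ = ((B.Δ ⊚ₘ B.Δ) ≫ D.ζ A A A A) ≫ (B.μ ⊛ₘ B.μ)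
  rw [h', Category.assoc]

/-- `∗` exchanges the unit axioms with the counit axioms: read in `C`, the claim is `LLC` up to
bracketing and expansion of `counitMul`. -/
theorem rru_op (h : D.LLC B) : D.op.RRU B.op := by
  have h' : _ = _ := h
  refine Quiver.Hom.unop_inj ?_
  change (((((((((((𝐉 ⊚ A) ◁⊚ B.Δ) ▷⊚ A) ≫ ((λ⊛ (𝐉 ⊚ A)).inv ▷⊚ (A ⊛ A)) ▷⊚ A) ≫
      D.ζ 𝐉 (𝐉 ⊚ A) A A ▷⊚ A) ≫ ((𝐉 ⊚ A) ◁⊛ (α⊚ 𝐉 A A).hom) ▷⊚ A) ≫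
      ((𝐉 ⊚ A) ◁⊛ (𝐉 ◁⊚ (B.μ ≫ B.ε))) ▷⊚ A) ≫ ((𝐉 ⊚ A) ◁⊛ D.ϖ) ▷⊚ A) ≫
      (ρ⊛ (𝐉 ⊚ A)).hom ▷⊚ A) ≫ (α⊚ 𝐉 A A).hom) ≫ 𝐉 ◁⊚ (B.μ ≫ B.ε)) ≫ D.ϖ =
    (((((α⊚ (𝐉 ⊚ A) A A).hom ≫ (𝐉 ⊚ A) ◁⊚ B.μ) ≫ (α⊚ 𝐉 A A).hom) ≫ 𝐉 ◁⊚ B.μ) ≫ 𝐉 ◁⊚ B.ε) ≫ D.ϖ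
  simp only [counitMul, @MonoidalCategory.whiskerLeft_comp C _ bullet,
    @MonoidalCategory.comp_whiskerRight C _ circ, Category.assoc] at h' ⊢
  exact h'

theorem llc_op (h : D.RRU B) : D.op.LLC B.op := by
  have h' : _ = _ := h
  refine Quiver.Hom.unop_inj ?_
  change (((((((D.δ ≫ 𝐈 ◁⊛ (B.η ≫ B.Δ)) ≫ (α⊛ 𝐈 A A).inv) ≫ (ρ⊚ (𝐈 ⊛ A)).inv ▷⊛ A) ≫
      ((𝐈 ⊛ A) ◁⊚ ((D.δ ≫ 𝐈 ◁⊛ (B.η ≫ B.Δ)) ≫ (α⊛ 𝐈 A A).inv)) ▷⊛ A) ≫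
      D.ζ 𝐈 A (𝐈 ⊛ A) A ▷⊛ A) ≫
      ((λ⊚ (𝐈 ⊛ A)).hom ▷⊛ (A ⊚ A)) ▷⊛ A) ≫
      ((𝐈 ⊛ A) ◁⊛ B.μ) ▷⊛ A) =
    ((((D.δ ≫ 𝐈 ◁⊛ B.η) ≫ 𝐈 ◁⊛ B.Δ) ≫ (α⊛ 𝐈 A A).inv) ≫ (𝐈 ⊛ A) ◁⊛ B.Δ) ≫
      (α⊛ (𝐈 ⊛ A) A A).inv
  simp only [@MonoidalCategory.whiskerLeft_comp C _ circ,
    @MonoidalCategory.comp_whiskerRight C _ bullet, Category.assoc] at h' ⊢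
  exact h'

/-- Reversing a product after `∗` amounts to reversing the other product before it. Each half of the
dual statement therefore draws on both the right axioms `h.1` and the left axioms `h.2`. -/
theorem isWeakBimonoid_op (h : D.IsWeakBimonoid B) : D.op.IsWeakBimonoid B.op where
  left :=
    { mulComul := D.mulComul_op B h.1.mulComul
      rru := D.rru_op B h.1.llc
      lru := D.circRev.rru_op B.circRev h.2.llc
      lrc := D.circRev.llc_op B.circRev h.2.rru
      llc := D.llc_op B h.1.rru }
  right :=
    { mulComul := D.bulletRev.mulComul_op B.bulletRev h.1.mulComul
      rru := D.bulletRev.rru_op B.bulletRev h.1.lrc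
      lru := D.circRev.bulletRev.rru_op B.circRev.bulletRev h.2.lrc
      lrc := D.circRev.bulletRev.llc_op B.circRev.bulletRev h.2.lru
      llc := D.bulletRev.llc_op B.bulletRev h.1.lru }

/-! ### Base objects of `A` in terms of the weak bimonad -/

section Translation

variable (h : D.IsRightWeakBimonoid B)

theorem sqcap_eq : D.sqcap B = (D.weakBimonad B h).sqR := by
  change _ = tUnit B (𝐉 ⊚ A) ≫ (λ⊛ (𝐉 ⊚ A)).inv ▷⊚ A ≫ D.tComul B 𝐉 (𝐉 ⊚ A) ≫
    (𝐉 ⊚ A) ◁⊛ (tMult B 𝐉 ≫ D.tCounit B) ≫ (ρ⊛ _).hom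
  simp only [sqcap, tUnit, tComul, tMult, tCounit, counitMul,
    @MonoidalCategory.whiskerLeft_comp C _ circ, Category.assoc,
    @MonoidalCategory.whisker_exchange_assoc C _ circ]

theorem bulletRev_sqcap_eq : D.bulletRev.sqcap B.bulletRev = (D.weakBimonad B h).sqL := by
  refine Eq.trans ?_ (?_ : tUnit B (𝐉 ⊚ A) ≫ (ρ⊛ (𝐉 ⊚ A)).inv ▷⊚ A ≫ D.tComul B (𝐉 ⊚ A) 𝐉 ≫
    (tMult B 𝐉 ≫ D.tCounit B) ▷⊛ (𝐉 ⊚ A) ≫ (λ⊛ _).hom = _)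
  · change (ρ⊚ (𝐉 ⊚ A)).inv ≫ (𝐉 ⊚ A) ◁⊚ (B.η ≫ B.Δ) ≫ (ρ⊛ (𝐉 ⊚ A)).inv ▷⊚ (A ⊛ A) ≫
      D.ζ (𝐉 ⊚ A) 𝐉 A A ≫ D.counitMul B ▷⊛ (𝐉 ⊚ A) ≫ (λ⊛ (𝐉 ⊚ A)).hom = _
    simp only [tUnit, tComul, tMult, tCounit, counitMul,
      @MonoidalCategory.whiskerLeft_comp C _ circ, Category.assoc,
      @MonoidalCategory.whisker_exchange_assoc C _ circ]
  · rfl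

theorem chi_eq {F G : C} (φ : F ⊚ A ⟶ F) (γ : G ⊚ A ⟶ G) :
    D.chi B φ γ = (D.weakBimonad B h).chi φ γ := by
  change _ = tUnit B _ ≫ D.tComul B F G ≫ (φ ⊛ₘ γ)
  simp only [chi, tUnit, tComul, @MonoidalCategory.whiskerLeft_comp C _ circ, Category.assoc]

theorem baseAct_eq {R : C} (r : Retract R (𝐉 ⊚ A)) : baseAct B r = (D.weakBimonad B h).act r := by
  change _ = r.i ▷⊚ A ≫ tMult B 𝐉 ≫ r.r
  simp only [baseAct, tMult, Category.assoc]

theorem baseOne_eq {R : C} (r : Retract R (𝐉 ⊚ A)) : baseOne B r = (D.weakBimonad B h).one r := by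
  change _ = tUnit B 𝐉 ≫ r.r
  simp only [baseOne, tUnit, Category.assoc]

theorem baseData_eq {R : C} (r : Retract R (𝐉 ⊚ A)) :
    D.baseData B r = (D.weakBimonad B h).data r := by
  rw [baseData, D.chi_eq B h, D.baseAct_eq B h, D.baseOne_eq B h]
  rfl

/-- The bimonad of `A` itself is used here, not that of its mirror image. This makes the two base
objects over `𝐉 ⊚ A` directly comparable, at the price of the mirrored formulas `data'`. -/
theorem bulletRev_baseData_eq {R : C} (r : Retract R (𝐉 ⊚ A)) :
    (D.bulletRev.baseData B.bulletRev r).unrev = (D.weakBimonad B h).data' r := by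
  refine Eq.trans (b := { mul := D.chi B (baseAct B r) (baseAct B r) ≫
                                D.baseCounit B r ▷⊛ R ≫ (λ⊛ R).hom
                          one := baseOne B r
                          comul := (λ⊛ R).inv ≫ baseOne B r ▷⊛ R ≫
                            D.chi B (baseAct B r) (baseAct B r)
                          counit := D.baseCounit B r }) rfl ?_
  rw [D.chi_eq B h, D.baseAct_eq B h, D.baseOne_eq B h]
  rfl

end Translation

/-! ### Splittings, and one pair of base objects -/

theorem exists_splitting {E : Type u} [Category.{v} E] [IsIdempotentComplete E] {X : E}
    {p : X ⟶ X} (hp : p ≫ p = p) : ∃ (Y : E) (r : Retract Y X), IsSplitting r p := by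
  obtain ⟨Y, i, e, h1, h2⟩ := IsIdempotentComplete.idempotents_split X p hp
  exact ⟨Y, ⟨i, e, h1⟩, h2⟩

theorem sqcap_idem (h : D.IsRightWeakBimonoid B) : D.sqcap B ≫ D.sqcap B = D.sqcap B := by
  rw [D.sqcap_eq B h]
  exact (D.weakBimonad B h).sqR_sqR

theorem bulletRev_sqcap_idem (h : D.IsRightWeakBimonoid B) :
    D.bulletRev.sqcap B.bulletRev ≫ D.bulletRev.sqcap B.bulletRev =
      D.bulletRev.sqcap B.bulletRev := by
  rw [D.bulletRev_sqcap_eq B h]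
  exact (D.weakBimonad B h).sqL_sqL

/-- The isomorphism is recorded in both directions, since some symmetries interchange the two
objects and passage to the opposite category reverses the arrow. -/
theorem baseData_properties (h : D.IsRightWeakBimonoid B) {X Y : C} (r : Retract X (𝐉 ⊚ A))
    (s : Retract Y (𝐉 ⊚ A)) (hr : IsSplitting r (D.sqcap B))
    (hs : IsSplitting s (D.bulletRev.sqcap B.bulletRev)) :
    (D.dataRCirc B r).IsMonoidAndComonoid ∧ (D.dataBarLCirc B s).IsMonoidAndComonoid ∧
      (D.dataRCirc B r).Isomorphic (D.dataBarLCirc B s) ∧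
      (D.dataBarLCirc B s).Isomorphic (D.dataRCirc B r) := by
  have hr' : r.r ≫ r.i = (D.weakBimonad B h).sqR := Eq.trans hr (D.sqcap_eq B h)
  have hs' : s.r ≫ s.i = (D.weakBimonad B h).sqL := Eq.trans hs (D.bulletRev_sqcap_eq B h)
  have br : (D.weakBimonad B h).IsBase r := WeakBimonad.isBase_of_sqR hr'
  have bs : (D.weakBimonad B h).IsBase s := WeakBimonad.isBase_of_sqL hs'
  have e1 : r.r ≫ r.i ≫ s.r = s.r := by rw [← Category.assoc, hr']; exact bs.sqR_r
  have e2 : s.r ≫ s.i ≫ r.r = r.r := by rw [← Category.assoc, hs']; exact br.sqL_r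
  rw [dataRCirc, dataBarLCirc, D.baseData_eq B h, D.bulletRev_baseData_eq B h, bs.data'_eq]
  exact ⟨br.isMonoidAndComonoid, bs.isMonoidAndComonoid, br.isomorphic bs e1 e2,
    bs.isomorphic br e2 e1⟩

end DuoidalStructure

/-! ### Return from the opposite category -/

namespace MonComonData

variable {V : MonoidalCategory C} {R S : C}

theorem IsMonoidAndComonoid.unop {P : MonComonData (opp V) (op R)} (h : P.IsMonoidAndComonoid) :
    P.unop.IsMonoidAndComonoid := by
  obtain ⟨⟨m, h1, h2⟩, c, h3, h4⟩ := h
  refine ⟨⟨@MonObj.mk C _ V R c.counit.unop c.comul.unop ?_ ?_ ?_, ?_, ?_⟩,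
    @ComonObj.mk C _ V R m.one.unop m.mul.unop ?_ ?_ ?_, ?_, ?_⟩
  · exact Quiver.Hom.op_inj c.counit_comul
  · exact Quiver.Hom.op_inj c.comul_counit
  · have := c.comul_assoc
    rw [← Category.assoc, ← Iso.comp_inv_eq] at this
    exact Quiver.Hom.op_inj this.symm
  · exact congrArg Quiver.Hom.unop h3
  · exact congrArg Quiver.Hom.unop h4
  · exact Quiver.Hom.op_inj m.one_mul
  · exact Quiver.Hom.op_inj m.mul_one
  · have := m.mul_assoc
    rw [← Iso.inv_comp_eq] at this
    exact Quiver.Hom.op_inj (this.symm.trans (Category.assoc _ _ _).symm)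
  · exact congrArg Quiver.Hom.unop h1
  · exact congrArg Quiver.Hom.unop h2

theorem Isomorphic.unop {P : MonComonData (opp V) (op R)} {Q : MonComonData (opp V) (op S)}
    (h : P.Isomorphic Q) : Q.unop.Isomorphic P.unop := by
  obtain ⟨e, h1, h2, h3, h4⟩ := h
  exact ⟨e.unop, Quiver.Hom.op_inj h3, Quiver.Hom.op_inj h4, Quiver.Hom.op_inj h1,
    Quiver.Hom.op_inj h2⟩

end MonComonData

end Duoidal

end Duoidal
-- The four pairs of base objects
theorem mainTheorem4 {C : Type u} [Category.{v} C] [IsIdempotentComplete C]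
    {circ bullet : MonoidalCategory C} (D : Duoidal.DuoidalStructure circ bullet)
    {A : C} (B : Duoidal.MonoidComonoid circ bullet A) (hB : D.IsWeakBimonoid B) :
    ((∃ (X : C) (h : Retract X (bullet.tensorObj A circ.tensorUnit)),
        Duoidal.IsSplitting h (D.sqcapLBullet B)) ∧
      (∃ (Y : C) (k : Retract Y (bullet.tensorObj A circ.tensorUnit)),
        Duoidal.IsSplitting k (D.sqcapBarLBullet B)) ∧
      ∀ (X Y : C) (h : Retract X (bullet.tensorObj A circ.tensorUnit))
        (k : Retract Y (bullet.tensorObj A circ.tensorUnit)),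
        Duoidal.IsSplitting h (D.sqcapLBullet B) → Duoidal.IsSplitting k (D.sqcapBarLBullet B) →
          (D.dataLBullet B h).IsMonoidAndComonoid ∧
          (D.dataBarLBullet B k).IsMonoidAndComonoid ∧
          (D.dataLBullet B h).Isomorphic (D.dataBarLBullet B k)) ∧
    ((∃ (X : C) (h : Retract X (bullet.tensorObj circ.tensorUnit A)),
        Duoidal.IsSplitting h (D.sqcapRBullet B)) ∧
      (∃ (Y : C) (k : Retract Y (bullet.tensorObj circ.tensorUnit A)),
        Duoidal.IsSplitting k (D.sqcapBarRBullet B)) ∧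
      ∀ (X Y : C) (h : Retract X (bullet.tensorObj circ.tensorUnit A))
        (k : Retract Y (bullet.tensorObj circ.tensorUnit A)),
        Duoidal.IsSplitting h (D.sqcapRBullet B) → Duoidal.IsSplitting k (D.sqcapBarRBullet B) →
          (D.dataRBullet B h).IsMonoidAndComonoid ∧
          (D.dataBarRBullet B k).IsMonoidAndComonoid ∧
          (D.dataRBullet B h).Isomorphic (D.dataBarRBullet B k)) ∧
    ((∃ (X : C) (h : Retract X (circ.tensorObj A bullet.tensorUnit)),
        Duoidal.IsSplitting h (D.sqcapLCirc B)) ∧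
      (∃ (Y : C) (k : Retract Y (circ.tensorObj A bullet.tensorUnit)),
        Duoidal.IsSplitting k (D.sqcapBarRCirc B)) ∧
      ∀ (X Y : C) (h : Retract X (circ.tensorObj A bullet.tensorUnit))
        (k : Retract Y (circ.tensorObj A bullet.tensorUnit)),
        Duoidal.IsSplitting h (D.sqcapLCirc B) → Duoidal.IsSplitting k (D.sqcapBarRCirc B) →
          (D.dataLCirc B h).IsMonoidAndComonoid ∧
          (D.dataBarRCirc B k).IsMonoidAndComonoid ∧
          (D.dataLCirc B h).Isomorphic (D.dataBarRCirc B k)) ∧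
    ((∃ (X : C) (h : Retract X (circ.tensorObj bullet.tensorUnit A)),
        Duoidal.IsSplitting h (D.sqcapRCirc B)) ∧
      (∃ (Y : C) (k : Retract Y (circ.tensorObj bullet.tensorUnit A)),
        Duoidal.IsSplitting k (D.sqcapBarLCirc B)) ∧
      ∀ (X Y : C) (h : Retract X (circ.tensorObj bullet.tensorUnit A))
        (k : Retract Y (circ.tensorObj bullet.tensorUnit A)),
        Duoidal.IsSplitting h (D.sqcapRCirc B) → Duoidal.IsSplitting k (D.sqcapBarLCirc B) →
          (D.dataRCirc B h).IsMonoidAndComonoid ∧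
          (D.dataBarLCirc B k).IsMonoidAndComonoid ∧
          (D.dataRCirc B h).Isomorphic (D.dataBarLCirc B k)) := by
  have op_idem {X : C} {p : op X ⟶ op X} (h : p ≫ p = p) : p.unop ≫ p.unop = p.unop :=
    Quiver.Hom.op_inj h
  have ho := D.isWeakBimonoid_op B hB
  refine ⟨⟨?_, ?_, fun X Y h k hh hk => ?_⟩, ⟨?_, ?_, fun X Y h k hh hk => ?_⟩,
    ⟨?_, ?_, fun X Y h k hh hk => ?_⟩, ?_, ?_, fun X Y h k hh hk => ?_⟩
  · exact Duoidal.DuoidalStructure.exists_splitting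
      (op_idem (D.op.circRev.bulletRev_sqcap_idem B.op.circRev ho.2))
  · exact Duoidal.DuoidalStructure.exists_splitting
      (op_idem (D.op.circRev.sqcap_idem B.op.circRev ho.2))
  -- The splitting `k` comes first: `⊓̄^L_•` is the image of `⊓^R_∘` under `∘` and `∗`, while
  -- `⊓^L_•` needs `•` as well. Undoing `op` turns the isomorphism back to the required direction.
  · obtain ⟨h1, h2, h3, -⟩ := D.op.circRev.baseData_properties B.op.circRev ho.2 k.op h.op
      (Quiver.Hom.unop_inj hk) (Quiver.Hom.unop_inj hh)
    exact ⟨h2.unop, h1.unop, h3.unop⟩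
  · exact Duoidal.DuoidalStructure.exists_splitting (op_idem (D.op.sqcap_idem B.op ho.1))
  · exact Duoidal.DuoidalStructure.exists_splitting
      (op_idem (D.op.bulletRev_sqcap_idem B.op ho.1))
  -- No interchange of roles here, so the reversal caused by `op` calls for the other isomorphism.
  · obtain ⟨h1, h2, -, h3⟩ := D.op.baseData_properties B.op ho.1 h.op k.op
      (Quiver.Hom.unop_inj hh) (Quiver.Hom.unop_inj hk)
    exact ⟨h1.unop, h2.unop, h3.unop⟩
  · exact Duoidal.DuoidalStructure.exists_splitting
      (D.circRev.bulletRev_sqcap_idem B.circRev hB.2)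
  · exact Duoidal.DuoidalStructure.exists_splitting (D.circRev.sqcap_idem B.circRev hB.2)
  · obtain ⟨h1, h2, -, h3⟩ := D.circRev.baseData_properties B.circRev hB.2 k h hk hh
    exact ⟨h2, h1, h3⟩
  · exact Duoidal.DuoidalStructure.exists_splitting (D.sqcap_idem B hB.1)
  · exact Duoidal.DuoidalStructure.exists_splitting (D.bulletRev_sqcap_idem B hB.1)
  · obtain ⟨h1, h2, h3, -⟩ := D.baseData_properties B hB.1 h k hh hk
    exact ⟨h1, h2, h3⟩
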